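/- **Theorem (Stochastic First Welfare Theorem).** Write $\mathbb{R}^2_{+}=[0,\infty)^2$, $\mathbb{R}_{++}=(0,\infty)$, and let $p\cdot c$ be the Euclidean inner product. *Utilities.* There are two goods and two households $h=1,2$. Household $h$ has a utility function $u_h:\mathbb{R}^2_+\to\mathbb{R}$ that is continuous, $C^\infty$ on $\mathbb{R}^2_{++}$ with $\nabla u_h\neq 0$ there, non-decreasing, strictly quasi-concave on $\mathbb{R}^2_{++}$, without local maxima, and satisfies $u_h(0)=0$. For $p\in\mathbb{R}^2_{++}$ and $w>0$ let $x_h(p,w)$ be the maximizer of $u_h$ on $\{c\in\mathbb{R}^2_+ : p\cdot c\le w\}$; it is assumed to lie in $\mathbb{R}^2_{++}$. Put $x_{nh}(p)=x_h(p,1)$ and $x_{nh}^{-1}(c)=\nabla u_h(c)/(\nabla u_h(c)\cdot c)$ for $c\in\mathbb{R}^2_{++}$. For $c,p\in\mathbb{R}^2_{++}$ write $r=x_{nh}^{-1}(c)$ and $d=x_{nh}(p/(p\cdot c))-c$. Both utilities are * *sharp*: for all $c,p\in\mathbb{R}^2_{++}$ and $i\ne j$, $p_i>p_jr_i/r_j$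 implies $d_i<0$, and $p_i<p_jr_i/r_j$ implies $d_i>0$; * *attractive*: for all $c,p\in\mathbb{R}^2_{++}$ and all $i,j$, $\left(\frac{r_i}{r_j}-\frac{p_i}{p_j}\right)\left(r_j\,(\mathbf{H}u_h(c)\,d)_i-r_i\,(\mathbf{H}u_h(c)\,d)_j\right)\le 0$, where $\mathbf{H}u_h$ is the Hessian. *Trade.* An allocation is $z=(z_1,z_2)$ with $z_1,z_2\in\mathbb{R}^2_{++}$. An allocation is Pareto optimal if no allocation with the same total $z_1+z_2$ gives both households at least the same utility and one of them strictly more; $\mathcal{P}$ is the set of Pareto optimal allocations. For an allocation $z$ and $p\in\mathbb{R}^2_{++}$ let $c_{z_h,p}(\tau)=z_h+\tau\,(x_{nh}(p/(p\cdot z_h))-z_h)$ and $$\mathcal{S}(z,p)=\Big\{\sigma\in[0,1]^2 : \textstyle\sum_h\sigma_h c_{z_h,p}'(0)=0,\ \sum_h\sigma_h\|c_{z_h,p}'(0)\|>0\Big\},\qquad \mathcal{T}(z)=\{q>0 : \mathcal{S}(z,(q,1))\ne\emptyset\}.$$ *Process.* Let $y$ be an allocation. On a probability space let $(Y_t)_{t\ge0}$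 be an allocation-valued process, $(Q_t)_{t\ge1}$ a real-valued process (prices) and $(S_t)_{t\ge1}$ an $\mathbb{R}^2$-valued process (relative trade speeds) such that, almost surely, $Y_0=y$ and for every $t\ge1$: * if $\mathcal{T}(Y_{t-1})\neq\emptyset$, then $Q_t\in\mathcal{T}(Y_{t-1})$, $S_t\in\mathcal{S}(Y_{t-1},(Q_t,1))$ and $Y_{t,h}=c_{Y_{t-1,h},(Q_t,1)}(S_{t,h})$ for $h=1,2$; * if $\mathcal{T}(Y_{t-1})=\emptyset$, then $Y_t=Y_{t-1}$, $S_t=0$, and $Q_t=\frac{\partial u_1/\partial c_1}{\partial u_1/\partial c_2}(Y_{t-1,1})$. Suppose the process is Bayesian: there are probability densities $f_Q:\mathbb{R}\to\mathbb{R}_+$ and $f_S:[0,1]^2\to\mathbb{R}_+$ with respect to Lebesgue measure such that, for all $t\ge1$ and all Borel sets $A\subseteq\mathbb{R}$, $B\subseteq\mathbb{R}^2$, almost surely $$\mathbb{P}(Q_t\in A\mid Y_{t-1})=\frac{\int_{\mathcal{T}(Y_{t-1})\cap A}f_Q}{\int_{\mathcal{T}(Y_{t-1})}f_Q},\qquad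 \mathbb{P}(S_t\in B\mid Y_{t-1},Q_t)=\frac{\int_{\mathcal{S}(Y_{t-1},(Q_t,1))\cap B}f_S}{\int_{\mathcal{S}(Y_{t-1},(Q_t,1))}f_S},$$ each equation being required where its denominator is positive. Suppose finally that $f_Q(q)>0$ for all $q\in\mathcal{T}(y)$ and that, for every $t\ge1$, almost surely $\|S_t\|_\infty=1$ whenever $\mathcal{T}(Y_{t-1})\ne\emptyset$. Then, with probability $1$, $\lim_{t\to\infty}Y_t$ exists and lies in $\mathcal{P}$. -/

import Mathlib

open MeasureTheory ProbabilityTheory Filter Topology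

namespace Trade

/-- The closed orthant `ℝ^L_+`. -/
def nonnegOrthant (L : ℕ) : Set (Fin L → ℝ) := {c | ∀ i, 0 ≤ c i}

/-- The open orthant `ℝ^L_{++}`. -/
def posOrthant (L : ℕ) : Set (Fin L → ℝ) := {c | ∀ i, 0 < c i}

/-- The set `ℝ^{HL}_{++}` of allocations: household `h` holds the bundle `y h`. -/
def allocations (H L : ℕ) : Set (Fin H → Fin L → ℝ) := {y | ∀ h, y h ∈ posOrthant L}

/-! ### Consumer theory -/

/-- The budget set `B(p,w)`. -/
def budgetSet {L : ℕ} (p : Fin L → ℝ) (w : ℝ) : Set (Fin L → ℝ) :=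
  {c | c ∈ nonnegOrthant L ∧ p ⬝ᵥ c ≤ w}

/-- `c` maximizes `u` over the budget set. -/
def IsDemanded {L : ℕ} (u : (Fin L → ℝ) → ℝ) (p : Fin L → ℝ) (w : ℝ) (c : Fin L → ℝ) : Prop :=
  c ∈ budgetSet p w ∧ ∀ c' ∈ budgetSet p w, u c' ≤ u c

/-- The Walrasian demand `x(p,w)`: the maximizer of `u` over the budget set. -/
noncomputable def walrasianDemand {L : ℕ} (u : (Fin L → ℝ) → ℝ) (p : Fin L → ℝ) (w : ℝ) :
    Fin L → ℝ :=
  Classical.epsilon (IsDemanded u p w)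

/-- The normalized Walrasian demand `x_n(p) = x(p,1)`. -/
noncomputable def normalizedDemand {L : ℕ} (u : (Fin L → ℝ) → ℝ) (p : Fin L → ℝ) : Fin L → ℝ :=
  walrasianDemand u p 1

/-- The gradient `∇u(c)`. -/
noncomputable def grad {L : ℕ} (u : (Fin L → ℝ) → ℝ) (c : Fin L → ℝ) : Fin L → ℝ :=
  fun i => fderiv ℝ u c (Pi.single i 1)

/-- The Hessian matrix `Hu(c)`. -/
noncomputable def hessian {L : ℕ} (u : (Fin L → ℝ) → ℝ) (c : Fin L → ℝ) :
    Matrix (Fin L) (Fin L) ℝ :=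
  Matrix.of fun i j => fderiv ℝ (fun c' => grad u c' j) c (Pi.single i 1)

/-- The inverse `x_n⁻¹(c) = ∇u(c) / (∇u(c) · c)` of the normalized Walrasian demand. -/
noncomputable def inverseDemand {L : ℕ} (u : (Fin L → ℝ) → ℝ) (c : Fin L → ℝ) : Fin L → ℝ :=
  (grad u c ⬝ᵥ c)⁻¹ • grad u c

/-- The standing assumptions on a utility function on `ℝ^L_+`. -/
structure IsUtility {L : ℕ} (u : (Fin L → ℝ) → ℝ) : Prop where
  continuousOn : ContinuousOn u (nonnegOrthant L)
  smooth : ContDiffOn ℝ ((⊤ : ℕ∞) : WithTop ℕ∞) u (posOrthant L)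
  map_zero : u 0 = 0
  monotoneOn : MonotoneOn u (nonnegOrthant L)
  strictQuasiconcave : ∀ c ∈ posOrthant L, ∀ c' ∈ posOrthant L, c ≠ c' →
    ∀ a b : ℝ, 0 < a → 0 < b → a + b = 1 → min (u c) (u c') < u (a • c + b • c')
  no_localMax : ∀ c ∈ nonnegOrthant L, ¬ IsLocalMaxOn u (nonnegOrthant L) c
  /-- Equivalently, the Lagrange multiplier of utility maximization is positive. -/
  gradient_ne_zero : ∀ c ∈ posOrthant L, grad u c ≠ 0
  /-- Utility maximization has no corner solutions. -/
  demand_interior : ∀ p ∈ posOrthant L, ∀ w : ℝ, 0 < w → walrasianDemand u p w ∈ posOrthant L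

/-- Sharp utility functions. -/
def IsSharp {L : ℕ} (u : (Fin L → ℝ) → ℝ) : Prop :=
  ∀ y ∈ posOrthant L, ∀ p ∈ posOrthant L, ∀ i : Fin L,
    ((∀ j, j ≠ i → p j * inverseDemand u y i / inverseDemand u y j < p i) →
      normalizedDemand u ((p ⬝ᵥ y)⁻¹ • p) i - y i < 0) ∧
    ((∀ j, j ≠ i → p i < p j * inverseDemand u y i / inverseDemand u y j) →
      0 < normalizedDemand u ((p ⬝ᵥ y)⁻¹ • p) i - y i)

/-- Attractive utility functions. The row vector `x_n⁻¹(y) (e_jᵀ e_i - e_iᵀ e_j)` is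
`r j • e_i - r i • e_j` with `r = x_n⁻¹(y)`. -/
def IsAttractive {L : ℕ} (u : (Fin L → ℝ) → ℝ) : Prop :=
  ∀ y ∈ posOrthant L, ∀ p ∈ posOrthant L, ∀ i j : Fin L,
    (inverseDemand u y i / inverseDemand u y j - p i / p j) *
      ((inverseDemand u y j • (Pi.single i 1 : Fin L → ℝ) -
          inverseDemand u y i • (Pi.single j 1 : Fin L → ℝ)) ⬝ᵥ
        (hessian u y).mulVec (normalizedDemand u ((p ⬝ᵥ y)⁻¹ • p) - y)) ≤ 0

/-! ### Pareto optimality -/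

/-- `z` Pareto dominates `y`. -/
def ParetoDominates {H L : ℕ} (u : Fin H → (Fin L → ℝ) → ℝ) (z y : Fin H → Fin L → ℝ) : Prop :=
  (∀ h, u h (y h) ≤ u h (z h)) ∧ (∃ h, u h (y h) < u h (z h)) ∧ ∑ h, z h = ∑ h, y h

/-- The set `𝒫` of Pareto optimal allocations. -/
def paretoSet {H L : ℕ} (u : Fin H → (Fin L → ℝ) → ℝ) : Set (Fin H → Fin L → ℝ) :=
  {y | y ∈ allocations H L ∧ ¬ ∃ z ∈ allocations H L, ParetoDominates u z y}

/-! ### Linear joint trade paths -/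

/-- The linear trade path `c_{y,p}(t) = y + t (x_n(p / p·y) - y)`. -/
noncomputable def linearTradePath {L : ℕ} (u : (Fin L → ℝ) → ℝ) (y p : Fin L → ℝ) (t : ℝ) :
    Fin L → ℝ :=
  y + t • (normalizedDemand u ((p ⬝ᵥ y)⁻¹ • p) - y)

/-- The set `𝒮(y,p)` of relative trade speeds. -/
def tradeSpeeds {H L : ℕ} (u : Fin H → (Fin L → ℝ) → ℝ) (y : Fin H → Fin L → ℝ)
    (p : Fin L → ℝ) : Set (Fin H → ℝ) :=
  {σ | (∀ h, σ h ∈ Set.Icc (0 : ℝ) 1) ∧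
    ∑ h, σ h • deriv (linearTradePath (u h) (y h) p) 0 = 0 ∧
    0 < ∑ h, σ h * ‖deriv (linearTradePath (u h) (y h) p) 0‖}

/-- The linear joint trade path `c_{y,p,σ}`. -/
noncomputable def jointTradePath {H L : ℕ} (u : Fin H → (Fin L → ℝ) → ℝ)
    (y : Fin H → Fin L → ℝ) (p : Fin L → ℝ) (σ : Fin H → ℝ) (t : ℝ) : Fin H → Fin L → ℝ :=
  fun h => linearTradePath (u h) (y h) p (σ h * t)

/-- The price vector `(q,1)`; there are `L = n + 1` goods and the last one is the numeraire. -/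
def priceOf {n : ℕ} (q : Fin n → ℝ) : Fin (n + 1) → ℝ := Fin.snoc (α := fun _ => ℝ) q 1

/-- The set `𝒯(y)` of trade-compatible normalized prices. -/
def tradePrices {H n : ℕ} (u : Fin H → (Fin (n + 1) → ℝ) → ℝ) (y : Fin H → Fin (n + 1) → ℝ) :
    Set (Fin n → ℝ) :=
  {q | q ∈ posOrthant n ∧ (tradeSpeeds u y (priceOf q)).Nonempty}

/-- The marginal substitution rates at `c` with respect to the last good: the first `L - 1`
coordinates of the flattening diffeomorphism. -/
noncomputable def substitutionRates {n : ℕ} (u : (Fin (n + 1) → ℝ) → ℝ) (c : Fin (n + 1) → ℝ) :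
    Fin n → ℝ :=
  fun i => grad u c i.castSucc / grad u c (Fin.last n)

/-! ### Stochastic non-tâtonnement dynamics -/

/-- `Y` is a stochastic non-tâtonnement process starting at `y`, with normalized prices `Q` and
relative trade speeds `S`; only `Q t`, `S t` with `1 ≤ t` matter. -/
structure IsSNTP {H n : ℕ} [NeZero H] {Ω : Type*} [MeasurableSpace Ω]
    (u : Fin H → (Fin (n + 1) → ℝ) → ℝ) (y : Fin H → Fin (n + 1) → ℝ) (P : Measure Ω)
    (Y : ℕ → Ω → Fin H → Fin (n + 1) → ℝ) (Q : ℕ → Ω → Fin n → ℝ) (S : ℕ → Ω → Fin H → ℝ) :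
    Prop where
  measurable_Y : ∀ t, Measurable (Y t)
  measurable_Q : ∀ t, Measurable (Q t)
  measurable_S : ∀ t, Measurable (S t)
  state : ∀ t ω, Y t ω ∈ allocations H (n + 1)
  start : ∀ᵐ ω ∂P, Y 0 ω = y
  trade : ∀ᵐ ω ∂P, ∀ t, (tradePrices u (Y t ω)).Nonempty →
    Q (t + 1) ω ∈ tradePrices u (Y t ω) ∧
    S (t + 1) ω ∈ tradeSpeeds u (Y t ω) (priceOf (Q (t + 1) ω)) ∧
    Y (t + 1) ω = jointTradePath u (Y t ω) (priceOf (Q (t + 1) ω)) (S (t + 1) ω) 1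
  rest : ∀ᵐ ω ∂P, ∀ t, tradePrices u (Y t ω) = ∅ →
    Q (t + 1) ω = substitutionRates (u 0) (Y t ω 0) ∧
    S (t + 1) ω = 0 ∧
    Y (t + 1) ω = Y t ω

/-- A Bayesian stochastic non-tâtonnement process with priors `fQ` and `fS`. Each Bayes quotient
is required where it is defined, that is, where its denominator is positive. -/
structure IsBSNTP {H n : ℕ} [NeZero H] {Ω : Type*} [MeasurableSpace Ω]
    (u : Fin H → (Fin (n + 1) → ℝ) → ℝ) (y : Fin H → Fin (n + 1) → ℝ) (P : Measure Ω)
    (Y : ℕ → Ω → Fin H → Fin (n + 1) → ℝ) (Q : ℕ → Ω → Fin n → ℝ) (S : ℕ → Ω → Fin H → ℝ)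
    (fQ : (Fin n → ℝ) → ℝ) (fS : (Fin H → ℝ) → ℝ) : Prop extends IsSNTP u y P Y Q S where
  fQ_nonneg : ∀ q, 0 ≤ fQ q
  fQ_integrable : Integrable fQ
  fQ_integral : ∫ q, fQ q = 1
  fS_nonneg : ∀ s ∈ Set.Icc (0 : Fin H → ℝ) 1, 0 ≤ fS s
  fS_integrable : IntegrableOn fS (Set.Icc (0 : Fin H → ℝ) 1)
  fS_integral : ∫ s in Set.Icc (0 : Fin H → ℝ) 1, fS s = 1
  bayes_Q : ∀ t, ∀ A : Set (Fin n → ℝ), MeasurableSet A → ∀ᵐ ω ∂P,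
    0 < ∫ q in tradePrices u (Y t ω), fQ q →
    (P⟦Q (t + 1) ⁻¹' A | MeasurableSpace.comap (Y t) inferInstance⟧) ω =
      (∫ q in tradePrices u (Y t ω) ∩ A, fQ q) / ∫ q in tradePrices u (Y t ω), fQ q
  bayes_S : ∀ t, ∀ B : Set (Fin H → ℝ), MeasurableSet B → ∀ᵐ ω ∂P,
    0 < ∫ s in tradeSpeeds u (Y t ω) (priceOf (Q (t + 1) ω)), fS s →
    (P⟦S (t + 1) ⁻¹' B |
        MeasurableSpace.comap (fun ω' => (Y t ω', Q (t + 1) ω')) inferInstance⟧) ω =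
      (∫ s in tradeSpeeds u (Y t ω) (priceOf (Q (t + 1) ω)) ∩ B, fS s) /
        ∫ s in tradeSpeeds u (Y t ω) (priceOf (Q (t + 1) ω)), fS s

end Trade

/-! With two goods and two households, everything is governed by the two marginal rates of
substitution. Sharpness says that a household buys good 0 at price `q` when `q` is below its rate
and sells when above, so the trade-compatible prices are exactly those strictly between the two
rates (`mem_tradePrices_iff`). Attractiveness makes each rate move towards the trading price, and
sharpness along the path prevents overshooting (`rate_trade_mem`). Hence the price intervals are
nested in time, while utilities never decrease.

At full speed some household reaches its demand, its rate becomes the trading price, and this price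
leaves the interval (`not_mem_tradePrices_trade`). If a fixed interval `(a,b)` is still
trade-compatible, Bayes' rule puts the next price in it with conditional probability at least its
prior mass `ε > 0`, which destroys it. So `(a,b)` survives `t` rounds with probability at most `(1 -
ε) ^ t`, hence almost surely not forever (`IsBSNTP.ae_not_forall_tradingAt`). Applied to all
rational intervals, this makes both rates converge to one price `q`.

Feasible allocations have cluster points by compactness, and at each of them both households demand
what they hold at prices `(q,1)`. Such an equilibrium is Pareto optimal, and by strict
quasi-concavity no other allocation with the same total is weakly better for everyone
(`eq_of_isDemanded_of_sum_eq`). Monotone utilities give all cluster points equal utilities, so they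
coincide and the process converges (`exists_tendsto_paretoSet`). -/

namespace Trade

/-! ### Existence, uniqueness and stability of demand -/

section Demand

variable {L : ℕ} {u : (Fin L → ℝ) → ℝ} {p c x : Fin L → ℝ} {w : ℝ}

lemma posOrthant_subset_nonnegOrthant : posOrthant L ⊆ nonnegOrthant L :=
  fun _ h i => (h i).le

lemma isOpen_posOrthant : IsOpen (posOrthant L) := by
  have : posOrthant L = ⋂ i, {c | 0 < c i} := by ext; simp [posOrthant]
  rw [this]
  exact isOpen_iInter_of_finite fun i => isOpen_lt continuous_const (continuous_apply i)

lemma isClosed_nonnegOrthant : IsClosed (nonnegOrthant L) := by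
  have : nonnegOrthant L = ⋂ i, {c | 0 ≤ c i} := by ext; simp [nonnegOrthant]
  rw [this]
  exact isClosed_iInter fun i => isClosed_le continuous_const (continuous_apply i)

lemma combo_mem_posOrthant {a b : ℝ} (hx : x ∈ posOrthant L) (hc : c ∈ nonnegOrthant L)
    (ha : 0 < a) (hb : 0 ≤ b) : a • x + b • c ∈ posOrthant L := fun i => by
  have h1 := hx i
  have h2 := hc i
  simp only [Pi.add_apply, Pi.smul_apply, smul_eq_mul]
  positivity

lemma continuous_dotProduct_left (p : Fin L → ℝ) : Continuous fun c : Fin L → ℝ => p ⬝ᵥ c := by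
  unfold dotProduct
  fun_prop

lemma dotProduct_pos_of_mem (hp : p ∈ posOrthant L) (hc : c ∈ nonnegOrthant L) (h0 : c ≠ 0) :
    0 < p ⬝ᵥ c := by
  obtain ⟨i, hi⟩ := Function.ne_iff.mp h0
  exact Finset.sum_pos' (fun j _ => mul_nonneg (hp j).le (hc j))
    ⟨i, Finset.mem_univ i, mul_pos (hp i) (lt_of_le_of_ne (hc i) (Ne.symm hi))⟩

lemma isCompact_budgetSet (hp : p ∈ posOrthant L) : IsCompact (budgetSet p w) := by
  have hclosed : IsClosed (budgetSet p w) :=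
    isClosed_nonnegOrthant.inter (isClosed_le (continuous_dotProduct_left p) continuous_const)
  refine (isCompact_Icc (a := (0 : Fin L → ℝ)) (b := fun i => w / p i)).of_isClosed_subset hclosed ?_
  rintro c ⟨hc, hw⟩
  refine ⟨hc, fun i => ?_⟩
  rw [le_div_iff₀ (hp i)]
  have : p i * c i ≤ p ⬝ᵥ c := Finset.single_le_sum (f := fun i => p i * c i)
    (fun j _ => mul_nonneg (hp j).le (hc j)) (Finset.mem_univ i)
  linarith

/-- `walrasianDemand` is an `epsilon` choice, so it has meaning only once compactness of the budget
set provides a maximizer. -/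
lemma isDemanded_walrasianDemand (hu : IsUtility u) (hp : p ∈ posOrthant L) (hw : 0 ≤ w) :
    IsDemanded u p w (walrasianDemand u p w) := by
  obtain ⟨x, hx, hmax⟩ := (isCompact_budgetSet (w := w) hp).exists_isMaxOn
    ⟨0, fun _ => le_rfl, by simpa using hw⟩ (hu.continuousOn.mono fun _ h => h.1)
  exact Classical.epsilon_spec (p := IsDemanded u p w) ⟨x, hx, fun c' hc' => hmax hc'⟩

lemma IsUtility.tendsto (hu : IsUtility u) {ι : Type*} {l : Filter ι} {f : ι → Fin L → ℝ}
    (hf : Tendsto f l (𝓝 c)) (hc : c ∈ nonnegOrthant L) (h : ∀ᶠ i in l, f i ∈ nonnegOrthant L) :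
    Tendsto (fun i => u (f i)) l (𝓝 (u c)) :=
  (hu.continuousOn c hc).tendsto.comp (tendsto_nhdsWithin_iff.mpr ⟨hf, h⟩)

lemma IsUtility.min_le_of_posOrthant (hu : IsUtility u) (hx : x ∈ posOrthant L)
    (hc : c ∈ posOrthant L) {a b : ℝ} (ha : 0 < a) (hb : 0 < b) (hab : a + b = 1) :
    min (u x) (u c) ≤ u (a • x + b • c) := by
  by_cases h : x = c
  · subst h
    rw [← add_smul, hab, one_smul, min_self]
  · exact (hu.strictQuasiconcave x hx c hc h a b ha hb hab).le

/-- Quasi-concavity, with one of the two bundles possibly on the boundary. -/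
lemma IsUtility.min_le (hu : IsUtility u) (hx : x ∈ posOrthant L)
    (hc : c ∈ nonnegOrthant L) {a b : ℝ} (ha : 0 < a) (hb : 0 < b) (hab : a + b = 1) :
    min (u x) (u c) ≤ u (a • x + b • c) := by
  -- Push the possibly boundary bundle `c` into the interior, use interior quasi-concavity there,
  -- and let the push tend to zero.
  let g : ℝ → Fin L → ℝ := fun δ => δ • x + (1 - δ) • c
  have hg : Tendsto g (𝓝[>] 0) (𝓝 c) := by
    have : Continuous g := by fun_prop
    have h := (this.tendsto 0).mono_left (nhdsWithin_le_nhds (s := Set.Ioi 0))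
    simpa [g] using h
  have hpos : ∀ᶠ δ in 𝓝[>] (0 : ℝ), g δ ∈ posOrthant L := by
    filter_upwards [Ioo_mem_nhdsGT (zero_lt_one' ℝ)] with δ hδ
    exact combo_mem_posOrthant hx hc hδ.1 (by linarith [hδ.2])
  have hmem : a • x + b • c ∈ nonnegOrthant L :=
    posOrthant_subset_nonnegOrthant (combo_mem_posOrthant hx hc ha hb.le)
  have h1 : Tendsto (fun δ => min (u x) (u (g δ))) (𝓝[>] 0) (𝓝 (min (u x) (u c))) :=
    tendsto_const_nhds.min
      (hu.tendsto hg hc (hpos.mono fun _ h => posOrthant_subset_nonnegOrthant h))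
  have h2 : Tendsto (fun δ => u (a • x + b • g δ)) (𝓝[>] 0) (𝓝 (u (a • x + b • c))) :=
    hu.tendsto (tendsto_const_nhds.add (hg.const_smul b)) hmem (hpos.mono fun δ h =>
      posOrthant_subset_nonnegOrthant
        (combo_mem_posOrthant hx (posOrthant_subset_nonnegOrthant h) ha hb.le))
  exact le_of_tendsto_of_tendsto h1 h2
    (hpos.mono fun δ h => hu.min_le_of_posOrthant hx h ha hb hab)

lemma combo_mem_budgetSet (hx : x ∈ budgetSet p w) (hc : c ∈ budgetSet p w) {a b : ℝ}
    (ha : 0 ≤ a) (hb : 0 ≤ b) (hab : a + b = 1) : a • x + b • c ∈ budgetSet p w := by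
  refine ⟨fun i => ?_, ?_⟩
  · have h1 := hx.1 i
    have h2 := hc.1 i
    simp only [Pi.add_apply, Pi.smul_apply, smul_eq_mul]
    positivity
  · rw [dotProduct_add, dotProduct_smul, dotProduct_smul, smul_eq_mul, smul_eq_mul]
    have h1 := mul_le_mul_of_nonneg_left hx.2 ha
    have h2 := mul_le_mul_of_nonneg_left hc.2 hb
    have h3 : a * w + b * w = w := by rw [← add_mul, hab, one_mul]
    linarith

/-- Demand is unique. -/
lemma IsDemanded.eq_walrasianDemand (hu : IsUtility u) (hp : p ∈ posOrthant L) (hw : 0 < w)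
    (hc : IsDemanded u p w c) : c = walrasianDemand u p w := by
  set x := walrasianDemand u p w with hx_def
  have hx : IsDemanded u p w x := isDemanded_walrasianDemand hu hp hw.le
  have hxpos : x ∈ posOrthant L := hu.demand_interior p hp w hw
  by_contra hne
  have h2 : (0 : ℝ) < 1 / 2 := by norm_num
  -- Strict quasi-concavity holds only in the interior and `c` may lie on the boundary. The midpoint
  -- `m` is interior and weakly optimal, so the midpoint of `x` and `m` beats `x`.
  set m : Fin L → ℝ := (1 / 2 : ℝ) • x + (1 / 2 : ℝ) • c with hm
  have hmpos : m ∈ posOrthant L := combo_mem_posOrthant hxpos hc.1.1 h2 h2.le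
  have hmb : m ∈ budgetSet p w := combo_mem_budgetSet hx.1 hc.1 h2.le h2.le (by norm_num)
  have hmu : u x ≤ u m := by
    refine le_trans ?_ (hu.min_le hxpos hc.1.1 h2 h2 (by norm_num))
    exact le_min le_rfl (hc.2 x hx.1)
  have hxm : x ≠ m := by
    intro h
    apply hne
    ext i
    have := congrFun h i
    simp only [hm, Pi.add_apply, Pi.smul_apply, smul_eq_mul] at this
    linarith
  have hlt := hu.strictQuasiconcave x hxpos m hmpos hxm _ _ h2 h2 (by norm_num)
  rw [min_eq_left hmu] at hlt
  exact absurd (hx.2 _ (combo_mem_budgetSet hx.1 hmb h2.le h2.le (by norm_num))) (not_le.mpr hlt)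

/-- Scaling prices and wealth together leaves the budget set unchanged. -/
lemma normalizedDemand_inv_smul (hw : 0 < w) :
    normalizedDemand u (w⁻¹ • p) = walrasianDemand u p w := by
  have hB : budgetSet (w⁻¹ • p) 1 = budgetSet p w := by
    ext c
    simp only [budgetSet, Set.mem_ofPred_eq, smul_dotProduct, smul_eq_mul]
    rw [inv_mul_le_iff₀ hw, mul_one]
  unfold normalizedDemand walrasianDemand
  congr 1
  ext c
  simp only [IsDemanded, hB]

/-! ### First order conditions -/

lemma IsUtility.contDiffAt (hu : IsUtility u) (hc : c ∈ posOrthant L) :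
    ContDiffAt ℝ ((⊤ : ℕ∞) : WithTop ℕ∞) u c :=
  hu.smooth.contDiffAt (isOpen_posOrthant.mem_nhds hc)

lemma fderiv_eq_grad_dotProduct (v : Fin L → ℝ) : fderiv ℝ u c v = grad u c ⬝ᵥ v := by
  conv_lhs => rw [← Finset.univ_sum_single v]
  rw [map_sum]
  refine Finset.sum_congr rfl fun i _ => ?_
  have : (Pi.single i (v i) : Fin L → ℝ) = v i • Pi.single i 1 := by
    rw [← Pi.single_smul, smul_eq_mul, mul_one]
  rw [this, map_smul, smul_eq_mul, mul_comm]
  rfl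

lemma IsUtility.hasDerivAt_line (hu : IsUtility u) (hc : c ∈ posOrthant L) (v : Fin L → ℝ) :
    HasDerivAt (fun t : ℝ => u (c + t • v)) (grad u c ⬝ᵥ v) 0 := by
  have hd : HasFDerivAt u (fderiv ℝ u c) (c + (0 : ℝ) • v) := by
    simpa using ((hu.contDiffAt hc).differentiableAt (by simp)).hasFDerivAt
  have hl : HasDerivAt (fun t : ℝ => c + t • v) v 0 := by
    simpa using ((hasDerivAt_id (0 : ℝ)).smul_const v).const_add c
  rw [← fderiv_eq_grad_dotProduct]
  exact hd.comp_hasDerivAt 0 hl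

lemma eventually_line_mem_posOrthant (hc : c ∈ posOrthant L) (v : Fin L → ℝ) :
    ∀ᶠ t in 𝓝 (0 : ℝ), c + t • v ∈ posOrthant L := by
  have h : Continuous fun t : ℝ => c + t • v := by fun_prop
  exact h.continuousAt.eventually_mem (isOpen_posOrthant.mem_nhds (by simpa using hc))

lemma nonneg_of_hasDerivAt_of_eventually_le {f : ℝ → ℝ} {f' : ℝ} (hf : HasDerivAt f f' 0)
    (h : ∀ᶠ t in 𝓝[>] (0 : ℝ), f 0 ≤ f t) : 0 ≤ f' := by
  have hs := hf.tendsto_slope_zero_right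
  refine ge_of_tendsto hs ?_
  filter_upwards [h, self_mem_nhdsWithin] with t ht ht0
  rw [zero_add, smul_eq_mul]
  exact mul_nonneg (inv_nonneg.mpr (le_of_lt ht0)) (by linarith)

lemma IsUtility.grad_nonneg (hu : IsUtility u) (hc : c ∈ posOrthant L) (i : Fin L) :
    0 ≤ grad u c i := by
  have hd := hu.hasDerivAt_line hc (Pi.single i 1)
  rw [dotProduct_single, mul_one] at hd
  refine nonneg_of_hasDerivAt_of_eventually_le hd ?_
  filter_upwards [nhdsWithin_le_nhds (eventually_line_mem_posOrthant hc (Pi.single i 1)),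
    self_mem_nhdsWithin] with t ht ht0
  refine hu.monotoneOn ?_ (posOrthant_subset_nonnegOrthant ht) ?_
  · simpa using posOrthant_subset_nonnegOrthant hc
  · intro j
    have : 0 ≤ (Pi.single i 1 : Fin L → ℝ) j := by
      by_cases h : j = i
      · subst h; simp
      · simp [h]
    have ht0' : (0 : ℝ) < t := ht0
    have := mul_nonneg ht0'.le this
    simpa using this

/-- Otherwise monotonicity would give `u ≤ 0` on the box below `c`, making the origin a local
maximum. This later keeps limit bundles away from zero. -/
lemma IsUtility.pos_of_mem_posOrthant (hu : IsUtility u) (hc : c ∈ posOrthant L) : 0 < u c := by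
  have h0 : ∀ x ∈ nonnegOrthant L, 0 ≤ u x := fun x hx => by
    rw [← hu.map_zero]
    exact hu.monotoneOn (fun _ => le_rfl) hx hx
  by_contra hneg
  refine hu.no_localMax 0 (fun _ => le_rfl) ?_
  have hev : ∀ᶠ x in 𝓝 (0 : Fin L → ℝ), ∀ i, x i < c i :=
    eventually_all.mpr fun i => (continuous_apply i).continuousAt.eventually_lt
      continuousAt_const (hc i)
  filter_upwards [nhdsWithin_le_nhds hev, self_mem_nhdsWithin] with x hx hx0
  rw [hu.map_zero]
  exact (hu.monotoneOn hx0 (posOrthant_subset_nonnegOrthant hc) fun i => (hx i).le).trans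
    (not_lt.mp hneg)

lemma IsDemanded.budget_eq (hu : IsUtility u) (hc : c ∈ posOrthant L)
    (h : IsDemanded u p w c) : p ⬝ᵥ c = w := by
  refine le_antisymm h.1.2 (not_lt.mp fun hlt => ?_)
  refine hu.no_localMax c (posOrthant_subset_nonnegOrthant hc) ?_
  have hev : ∀ᶠ x in 𝓝 c, p ⬝ᵥ x < w :=
    (continuous_dotProduct_left p).continuousAt.eventually_lt continuousAt_const hlt
  filter_upwards [nhdsWithin_le_nhds hev, self_mem_nhdsWithin] with x hx hx0
  exact h.2 x ⟨hx0, hx.le⟩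

/-- The gradient at an interior demand is orthogonal to the budget hyperplane. -/
lemma IsDemanded.grad_dotProduct_eq_zero (hu : IsUtility u) (hc : c ∈ posOrthant L)
    (h : IsDemanded u p w c) {v : Fin L → ℝ} (hv : p ⬝ᵥ v = 0) : grad u c ⬝ᵥ v = 0 := by
  have hd := hu.hasDerivAt_line hc v
  refine IsLocalMax.hasDerivAt_eq_zero ?_ hd
  filter_upwards [eventually_line_mem_posOrthant hc v] with t ht
  simp only [zero_smul, add_zero]
  refine h.2 _ ⟨posOrthant_subset_nonnegOrthant ht, ?_⟩
  rw [dotProduct_add, dotProduct_smul, hv, smul_zero, add_zero]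
  exact h.1.2

/-- The first order condition is sufficient. -/
lemma isDemanded_of_grad_eq (hu : IsUtility u) (hc : c ∈ posOrthant L)
    (hw : 0 < p ⬝ᵥ c) {k : ℝ} (hk : 0 < k) (hg : grad u c = k • p) :
    IsDemanded u p (p ⬝ᵥ c) c := by
  have hcn := posOrthant_subset_nonnegOrthant hc
  refine ⟨⟨hcn, le_rfl⟩, fun x hx => not_lt.mp fun hlt => ?_⟩
  -- The weights `ε / 2` and `1 - ε` sum to less than one: for small `ε` the bundle is interior,
  -- still better than `c`, and strictly cheaper. Quasi-concavity then makes the derivative of `u`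
  -- towards it nonnegative, although the gradient is a positive multiple of `p`.
  have hcont : Tendsto (fun ε : ℝ => (ε / 2) • c + (1 - ε) • x) (𝓝[>] 0) (𝓝 x) := by
    have : Continuous fun ε : ℝ => (ε / 2) • c + (1 - ε) • x := by fun_prop
    have h := (this.tendsto 0).mono_left (nhdsWithin_le_nhds (s := Set.Ioi 0))
    simpa using h
  have hpos : ∀ᶠ ε in 𝓝[>] (0 : ℝ), (ε / 2) • c + (1 - ε) • x ∈ posOrthant L := by
    filter_upwards [Ioo_mem_nhdsGT (zero_lt_one' ℝ)] with ε hε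
    exact combo_mem_posOrthant hc hx.1 (half_pos hε.1) (by linarith [hε.2])
  have hu' := hu.tendsto hcont hx.1 (hpos.mono fun _ h => posOrthant_subset_nonnegOrthant h)
  obtain ⟨ε, hε1, hε2, hε3⟩ := (hpos.and ((hu'.eventually_const_lt hlt).and
    (Ioo_mem_nhdsGT (zero_lt_one' ℝ)))).exists
  set e := (ε / 2) • c + (1 - ε) • x with he
  have hpe : p ⬝ᵥ e < p ⬝ᵥ c := by
    rw [he, dotProduct_add, dotProduct_smul, dotProduct_smul, smul_eq_mul, smul_eq_mul]
    nlinarith [hx.2, hε3.1, hε3.2, mul_pos hε3.1 hw]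
  have hd := hu.hasDerivAt_line hc (e - c)
  have h0 : 0 ≤ grad u c ⬝ᵥ (e - c) := by
    refine nonneg_of_hasDerivAt_of_eventually_le hd ?_
    filter_upwards [Ioo_mem_nhdsGT (zero_lt_one' ℝ)] with t ht
    have hle := hu.min_le_of_posOrthant hc hε1 (a := 1 - t) (b := t) (by linarith [ht.2]) ht.1
      (by ring)
    rw [min_eq_left hε2.le] at hle
    convert hle using 2
    · simp
    · module
  rw [hg, smul_dotProduct, dotProduct_sub, smul_eq_mul] at h0
  nlinarith

/-- Limits of demanded bundles are demanded. -/
lemma isDemanded_of_tendsto (hu : IsUtility u) {ι : Type*} {l : Filter ι} [l.NeBot]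
    {f pr : ι → Fin L → ℝ}
    (hf : Tendsto f l (𝓝 c)) (hpr : Tendsto pr l (𝓝 p)) (hw : 0 < p ⬝ᵥ c)
    (h : ∀ i, IsDemanded u (pr i) (pr i ⬝ᵥ f i) (f i)) : IsDemanded u p (p ⬝ᵥ c) c := by
  have hc : c ∈ nonnegOrthant L :=
    isClosed_nonnegOrthant.mem_of_tendsto hf (Eventually.of_forall fun i => (h i).1.1)
  have hfu := hu.tendsto hf hc (Eventually.of_forall fun i => (h i).1.1)
  have hdot : ∀ {g : ι → Fin L → ℝ} {x : Fin L → ℝ}, Tendsto g l (𝓝 x) →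
      Tendsto (fun i => pr i ⬝ᵥ g i) l (𝓝 (p ⬝ᵥ x)) := fun {g x} hg =>
    tendsto_finsetSum _ fun j _ => ((tendsto_pi_nhds.mp hpr) j).mul ((tendsto_pi_nhds.mp hg) j)
  -- A strictly cheaper bundle is eventually affordable along the filter; bundles on the budget line
  -- are then reached by shrinking, which uses positive wealth.
  have key : ∀ x ∈ nonnegOrthant L, p ⬝ᵥ x < p ⬝ᵥ c → u x ≤ u c := fun x hx hlt => by
    refine ge_of_tendsto hfu ?_
    filter_upwards [(hdot tendsto_const_nhds).eventually_lt (hdot hf) hlt] with i hi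
    exact (h i).2 x ⟨hx, hi.le⟩
  refine ⟨⟨hc, le_rfl⟩, fun x hx => ?_⟩
  have hcont : Tendsto (fun ε : ℝ => (1 - ε) • x) (𝓝[>] 0) (𝓝 x) := by
    have : Continuous fun ε : ℝ => (1 - ε) • x := by fun_prop
    have h := (this.tendsto 0).mono_left (nhdsWithin_le_nhds (s := Set.Ioi 0))
    simpa using h
  have hmem : ∀ᶠ ε in 𝓝[>] (0 : ℝ), (1 - ε) • x ∈ nonnegOrthant L := by
    filter_upwards [Ioo_mem_nhdsGT (zero_lt_one' ℝ)] with ε hε i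
    exact mul_nonneg (by linarith [hε.2]) (hx.1 i)
  refine le_of_tendsto (hu.tendsto hcont hx.1 hmem) ?_
  filter_upwards [hmem, Ioo_mem_nhdsGT (zero_lt_one' ℝ)] with ε hε hε1
  refine key _ hε ?_
  rw [dotProduct_smul, smul_eq_mul]
  nlinarith [hx.2, hε1.1, hε1.2, mul_pos hε1.1 hw]

end Demand

/-! ### Welfare -/

/-- An equilibrium allocation is the only one with its total that is at least as good for all. -/
lemma eq_of_isDemanded_of_sum_eq {H L : ℕ} {u : Fin H → (Fin L → ℝ) → ℝ} {p : Fin L → ℝ}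
    {z z' : Fin H → Fin L → ℝ} (hu : ∀ h, IsUtility (u h)) (hz : z ∈ allocations H L)
    (hz' : z' ∈ allocations H L) (hd : ∀ h, IsDemanded (u h) p (p ⬝ᵥ z h) (z h))
    (hge : ∀ h, u h (z h) ≤ u h (z' h)) (hsum : ∑ h, z' h = ∑ h, z h) : z' = z := by
  by_contra hne
  obtain ⟨h₀, hh₀⟩ := Function.ne_iff.mp hne
  -- The midpoint of `z' h` and `z h` is strictly better than `z h`, hence unaffordable, so `z' h`
  -- costs more. Summing over households contradicts the equal totals.
  have hlt : ∀ h, z' h ≠ z h → p ⬝ᵥ z h < p ⬝ᵥ z' h := fun h hh => by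
    have h2 : (0 : ℝ) < 1 / 2 := by norm_num
    have hs := (hu h).strictQuasiconcave _ (hz' h) _ (hz h) hh _ _ h2 h2 (by norm_num)
    rw [min_eq_right (hge h)] at hs
    by_contra hle
    refine absurd ((hd h).2 _ ⟨posOrthant_subset_nonnegOrthant
      (combo_mem_posOrthant (hz' h) (posOrthant_subset_nonnegOrthant (hz h)) h2 h2.le), ?_⟩)
      (not_le.mpr hs)
    rw [dotProduct_add, dotProduct_smul, dotProduct_smul, smul_eq_mul, smul_eq_mul]
    linarith
  have hle : ∀ h, p ⬝ᵥ z h ≤ p ⬝ᵥ z' h := fun h => by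
    by_cases hh : z' h = z h
    · rw [hh]
    · exact (hlt h hh).le
  have : ∑ h, p ⬝ᵥ z h < ∑ h, p ⬝ᵥ z' h :=
    Finset.sum_lt_sum (fun h _ => hle h) ⟨h₀, Finset.mem_univ _, hlt h₀ hh₀⟩
  rw [← dotProduct_sum, ← dotProduct_sum, hsum] at this
  exact lt_irrefl _ this

lemma mem_paretoSet_of_isDemanded {H L : ℕ} {u : Fin H → (Fin L → ℝ) → ℝ} {p : Fin L → ℝ}
    {z : Fin H → Fin L → ℝ} (hu : ∀ h, IsUtility (u h)) (hz : z ∈ allocations H L)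
    (hd : ∀ h, IsDemanded (u h) p (p ⬝ᵥ z h) (z h)) : z ∈ paretoSet u := by
  refine ⟨hz, ?_⟩
  rintro ⟨z', hz', hge, ⟨h, hh⟩, hsum⟩
  rw [eq_of_isDemanded_of_sum_eq hu hz hz' hd hge hsum] at hh
  exact lt_irrefl _ hh

/-! ### Trade paths and second derivatives -/

section Shift

variable {L : ℕ} {u : (Fin L → ℝ) → ℝ} {p c : Fin L → ℝ}

lemma dotProduct_pos (hp : p ∈ posOrthant L) (hc : c ∈ posOrthant L) (hL : 0 < L) :
    0 < p ⬝ᵥ c :=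
  dotProduct_pos_of_mem hp (posOrthant_subset_nonnegOrthant hc) fun h => by
    have := hc ⟨0, hL⟩
    simp [h] at this

lemma linearTradePath_eq (hpc : 0 < p ⬝ᵥ c) (t : ℝ) :
    linearTradePath u c p t = c + t • (walrasianDemand u p (p ⬝ᵥ c) - c) := by
  rw [linearTradePath, normalizedDemand_inv_smul hpc]

lemma deriv_linearTradePath (hpc : 0 < p ⬝ᵥ c) :
    deriv (linearTradePath u c p) 0 = walrasianDemand u p (p ⬝ᵥ c) - c := by
  have h : linearTradePath u c p = fun t => c + t • (walrasianDemand u p (p ⬝ᵥ c) - c) :=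
    funext (linearTradePath_eq hpc)
  rw [h]
  have := ((hasDerivAt_id (0 : ℝ)).smul_const (walrasianDemand u p (p ⬝ᵥ c) - c)).const_add c
  rw [one_smul] at this
  exact this.deriv

lemma two_le_infty : (2 : WithTop ℕ∞) ≤ ((⊤ : ℕ∞) : WithTop ℕ∞) :=
  WithTop.coe_le_coe.mpr (le_top : (2 : ℕ∞) ≤ ⊤)

lemma IsUtility.differentiableAt_fderiv (hu : IsUtility u) (hc : c ∈ posOrthant L) :
    DifferentiableAt ℝ (fderiv ℝ u) c :=
  (((hu.contDiffAt hc).of_le two_le_infty).fderiv_right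
    (m := 1) (by norm_num)).differentiableAt (by norm_num)

lemma IsUtility.fderiv_grad_apply (hu : IsUtility u) (hc : c ∈ posOrthant L) (i : Fin L)
    (v : Fin L → ℝ) :
    fderiv ℝ (fun c' => grad u c' i) c v = fderiv ℝ (fderiv ℝ u) c v (Pi.single i 1) := by
  unfold grad
  rw [fderiv_clm_apply (hu.differentiableAt_fderiv hc) (differentiableAt_const _)]
  simp

/-- Row `i` of `hessian` differentiates in direction `i`, so symmetry of the second derivative is
what turns it into a derivative of the `i`-th partial along `v`. -/
lemma IsUtility.hessian_mulVec (hu : IsUtility u) (hc : c ∈ posOrthant L) (i : Fin L)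
    (v : Fin L → ℝ) :
    (hessian u c).mulVec v i = fderiv ℝ (fun c' => grad u c' i) c v := by
  have hsymm : IsSymmSndFDerivAt ℝ u c := (hu.contDiffAt hc).isSymmSndFDerivAt (by simpa using two_le_infty)
  rw [hu.fderiv_grad_apply hc, hsymm v (Pi.single i 1)]
  conv_rhs => rw [← Finset.univ_sum_single v]
  rw [map_sum]
  rw [Matrix.mulVec, dotProduct]
  refine Finset.sum_congr rfl fun j _ => ?_
  have : (Pi.single j (v j) : Fin L → ℝ) = v j • Pi.single j 1 := by
    rw [← Pi.single_smul, smul_eq_mul, mul_one]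
  rw [this, map_smul, smul_eq_mul, mul_comm, hessian, Matrix.of_apply, hu.fderiv_grad_apply hc]

lemma IsUtility.differentiableAt_grad (hu : IsUtility u) (hc : c ∈ posOrthant L) (i : Fin L) :
    DifferentiableAt ℝ (fun c' => grad u c' i) c :=
  (hu.differentiableAt_fderiv hc).clm_apply (differentiableAt_const _)

lemma IsUtility.hasDerivAt_grad_line (hu : IsUtility u) {v : Fin L → ℝ} {t : ℝ}
    (hc : c + t • v ∈ posOrthant L) (i : Fin L) :
    HasDerivAt (fun s : ℝ => grad u (c + s • v) i) ((hessian u (c + t • v)).mulVec v i) t := by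
  have hl : HasDerivAt (fun s : ℝ => c + s • v) v t := by
    simpa using ((hasDerivAt_id t).smul_const v).const_add c
  rw [hu.hessian_mulVec hc]
  exact (hu.differentiableAt_grad hc i).hasFDerivAt.comp_hasDerivAt t hl

/-- Trading towards the demanded bundle never lowers utility. -/
lemma IsUtility.le_of_trade (hu : IsUtility u) (hp : p ∈ posOrthant L) (hc : c ∈ posOrthant L)
    (hpc : 0 < p ⬝ᵥ c) {s : ℝ} (hs : s ∈ Set.Icc (0 : ℝ) 1) :
    u c ≤ u (c + s • (walrasianDemand u p (p ⬝ᵥ c) - c)) := by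
  set x := walrasianDemand u p (p ⬝ᵥ c) with hx
  have hxc : u c ≤ u x :=
    (isDemanded_walrasianDemand hu hp hpc.le).2 c ⟨posOrthant_subset_nonnegOrthant hc, le_rfl⟩
  rcases hs.1.eq_or_lt with h0 | h0
  · simp [← h0]
  rcases hs.2.eq_or_lt with h1 | h1
  · simpa [h1] using hxc
  have h := hu.min_le_of_posOrthant hc (hu.demand_interior p hp _ hpc) (sub_pos.mpr h1) h0
    (by ring)
  rw [← hx, min_eq_left hxc] at h
  convert h using 2
  module

lemma trade_mem_posOrthant (hu : IsUtility u) (hp : p ∈ posOrthant L) (hc : c ∈ posOrthant L)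
    (hpc : 0 < p ⬝ᵥ c) {s : ℝ} (hs : s ∈ Set.Icc (0 : ℝ) 1) :
    c + s • (walrasianDemand u p (p ⬝ᵥ c) - c) ∈ posOrthant L := by
  have hx := hu.demand_interior p hp _ hpc
  rcases hs.1.eq_or_lt with h0 | h0
  · simpa [← h0] using hc
  have := combo_mem_posOrthant hx (posOrthant_subset_nonnegOrthant hc) h0 (sub_nonneg.mpr hs.2)
  convert this using 1
  module

end Shift

/-! ### One household, two goods: the marginal rate of substitution -/

section TwoGoods

variable {u : (Fin 2 → ℝ) → ℝ} {c : Fin 2 → ℝ} {q : ℝ}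

/-- The marginal rate of substitution between two goods. -/
noncomputable def rate (u : (Fin 2 → ℝ) → ℝ) (c : Fin 2 → ℝ) : ℝ := grad u c 0 / grad u c 1

lemma pair_mem_posOrthant (hq : 0 < q) : (![q, 1] : Fin 2 → ℝ) ∈ posOrthant 2 := by
  intro i
  fin_cases i <;> simp [hq]

lemma pair_dotProduct (x : Fin 2 → ℝ) : ![q, 1] ⬝ᵥ x = q * x 0 + x 1 := by
  simp [dotProduct, Fin.sum_univ_two]

lemma pair_dotProduct_pos (hq : 0 < q) (hc : c ∈ posOrthant 2) : 0 < ![q, 1] ⬝ᵥ c :=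
  dotProduct_pos (pair_mem_posOrthant hq) hc two_pos

/-- The bundle demanded at prices `(q,1)` and endowment `c`. -/
noncomputable def target (u : (Fin 2 → ℝ) → ℝ) (c : Fin 2 → ℝ) (q : ℝ) : Fin 2 → ℝ :=
  walrasianDemand u ![q, 1] (![q, 1] ⬝ᵥ c)

lemma target_mem_posOrthant (hu : IsUtility u) (hc : c ∈ posOrthant 2) (hq : 0 < q) :
    target u c q ∈ posOrthant 2 :=
  hu.demand_interior _ (pair_mem_posOrthant hq) _ (pair_dotProduct_pos hq hc)

lemma isDemanded_target (hu : IsUtility u) (hc : c ∈ posOrthant 2) (hq : 0 < q) :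
    IsDemanded u ![q, 1] (![q, 1] ⬝ᵥ c) (target u c q) :=
  isDemanded_walrasianDemand hu (pair_mem_posOrthant hq) (pair_dotProduct_pos hq hc).le

lemma target_dotProduct (hu : IsUtility u) (hc : c ∈ posOrthant 2) (hq : 0 < q) :
    ![q, 1] ⬝ᵥ target u c q = ![q, 1] ⬝ᵥ c :=
  (isDemanded_target hu hc hq).budget_eq hu (target_mem_posOrthant hu hc hq)

/-- Budget balance: the trade in good 0 determines the whole trade. -/
lemma target_sub_one (hu : IsUtility u) (hc : c ∈ posOrthant 2) (hq : 0 < q) :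
    (target u c q - c) 1 = -q * (target u c q - c) 0 := by
  have h := target_dotProduct hu hc hq
  rw [pair_dotProduct, pair_dotProduct] at h
  simp only [Pi.sub_apply]
  linarith

lemma IsSharp.grad_pos (hu : IsUtility u) (hs : IsSharp u) (hc : c ∈ posOrthant 2) (i : Fin 2) :
    0 < grad u c i := by
  refine lt_of_le_of_ne (hu.grad_nonneg hc i) fun hi => ?_
  have hp := pair_mem_posOrthant one_pos
  have hneg : ∀ k, target u c 1 k - c k < 0 := fun k => by
    have h := (hs c hc _ hp k).1 ?_
    · rwa [normalizedDemand_inv_smul (pair_dotProduct_pos one_pos hc)] at h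
    · intro j hj
      -- If a partial derivative vanished, the ratio in the definition of sharpness would be `0` for
      -- both goods, once through its numerator and once through division by zero. Both net trades
      -- would be negative, against budget balance.
      have : inverseDemand u c k = 0 ∨ inverseDemand u c j = 0 := by
        have : k = i ∨ j = i := by omega
        rcases this with rfl | rfl
        · left; simp [inverseDemand, ← hi]
        · right; simp [inverseDemand, ← hi]
      rcases this with h | h <;> rw [h] <;> simpa using hp k
  have h1 := target_sub_one hu hc one_pos
  have h2 := hneg 0
  have h3 := hneg 1
  simp only [Pi.sub_apply] at h1
  linarith

lemma rate_pos (hu : IsUtility u) (hs : IsSharp u) (hc : c ∈ posOrthant 2) : 0 < rate u c :=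
  div_pos (hs.grad_pos hu hc 0) (hs.grad_pos hu hc 1)

lemma inverseDemand_factor_pos (hu : IsUtility u) (hs : IsSharp u) (hc : c ∈ posOrthant 2) :
    0 < (grad u c ⬝ᵥ c)⁻¹ :=
  inv_pos.mpr (dotProduct_pos (hs.grad_pos hu hc) hc two_pos)

lemma inverseDemand_div (hu : IsUtility u) (hs : IsSharp u) (hc : c ∈ posOrthant 2) :
    inverseDemand u c 0 / inverseDemand u c 1 = rate u c := by
  simp only [inverseDemand, Pi.smul_apply, smul_eq_mul, rate]
  exact mul_div_mul_left _ _ (inverseDemand_factor_pos hu hs hc).ne'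

lemma target_lt (hu : IsUtility u) (hs : IsSharp u) (hc : c ∈ posOrthant 2) (hq : 0 < q)
    (h : rate u c < q) : (target u c q - c) 0 < 0 := by
  have h' := (hs c hc _ (pair_mem_posOrthant hq) 0).1 ?_
  · rwa [normalizedDemand_inv_smul (pair_dotProduct_pos hq hc)] at h'
  · intro j hj
    have : j = 1 := by omega
    subst this
    rw [mul_div_assoc, inverseDemand_div hu hs hc]
    simpa using h

lemma lt_target (hu : IsUtility u) (hs : IsSharp u) (hc : c ∈ posOrthant 2) (hq : 0 < q)
    (h : q < rate u c) : 0 < (target u c q - c) 0 := by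
  have h' := (hs c hc _ (pair_mem_posOrthant hq) 0).2 ?_
  · rwa [normalizedDemand_inv_smul (pair_dotProduct_pos hq hc)] at h'
  · intro j hj
    have : j = 1 := by omega
    subst this
    rw [mul_div_assoc, inverseDemand_div hu hs hc]
    simpa using h

/-- The gradient is a positive multiple of `(rate, 1)`, so the first order condition holds at these
prices. -/
lemma isDemanded_rate (hu : IsUtility u) (hs : IsSharp u) (hc : c ∈ posOrthant 2) :
    IsDemanded u ![rate u c, 1] (![rate u c, 1] ⬝ᵥ c) c := by
  have h1 := hs.grad_pos hu hc 1
  refine isDemanded_of_grad_eq hu hc (pair_dotProduct_pos (rate_pos hu hs hc) hc) h1 ?_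
  ext i
  fin_cases i
  · simp [rate, mul_div_cancel₀ _ h1.ne']
  · simp

lemma target_eq_self (hu : IsUtility u) (hs : IsSharp u) (hc : c ∈ posOrthant 2) :
    target u c (rate u c) = c := by
  have hq := rate_pos hu hs hc
  exact ((isDemanded_rate hu hs hc).eq_walrasianDemand hu (pair_mem_posOrthant hq)
    (pair_dotProduct_pos hq hc)).symm

lemma rate_target (hu : IsUtility u) (hs : IsSharp u) (hc : c ∈ posOrthant 2) (hq : 0 < q) :
    rate u (target u c q) = q := by
  have hx := target_mem_posOrthant hu hc hq
  -- `(1, -q)` spans the budget line.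
  have hv : ![q, 1] ⬝ᵥ ![1, -q] = 0 := by simp
  have h := (isDemanded_target hu hc hq).grad_dotProduct_eq_zero hu hx hv
  simp only [dotProduct, Fin.sum_univ_two, Matrix.cons_val_zero, Matrix.cons_val_one] at h
  rw [rate, div_eq_iff (hs.grad_pos hu hx 1).ne']
  linarith

lemma rate_sub_mul_target_nonneg (hu : IsUtility u) (hs : IsSharp u) (hc : c ∈ posOrthant 2)
    (hq : 0 < q) : 0 ≤ (rate u c - q) * (target u c q - c) 0 := by
  rcases lt_trichotomy (rate u c) q with h | h | h
  · exact (mul_pos_of_neg_of_neg (sub_neg.mpr h) (target_lt hu hs hc hq h)).le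
  · simp [h]
  · exact (mul_pos (sub_pos.mpr h) (lt_target hu hs hc hq h)).le

/-- The path stays on the budget line, so wealth and demand are constant along it. -/
lemma target_trade (hu : IsUtility u) (hc : c ∈ posOrthant 2) (hq : 0 < q) (t : ℝ) :
    target u (c + t • (target u c q - c)) q = target u c q := by
  rw [target, dotProduct_add, dotProduct_smul, dotProduct_sub, target_dotProduct hu hc hq,
    sub_self, smul_zero, add_zero, ← target]

lemma target_sub_trade (hu : IsUtility u) (hc : c ∈ posOrthant 2) (hq : 0 < q) (t : ℝ) :
    target u (c + t • (target u c q - c)) q - (c + t • (target u c q - c)) =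
      (1 - t) • (target u c q - c) := by
  rw [target_trade hu hc hq]
  module

lemma target_path_mem (hu : IsUtility u) (hc : c ∈ posOrthant 2) (hq : 0 < q) {t : ℝ}
    (ht : t ∈ Set.Icc (0 : ℝ) 1) : c + t • (target u c q - c) ∈ posOrthant 2 :=
  trade_mem_posOrthant hu (pair_mem_posOrthant hq) hc (pair_dotProduct_pos hq hc) ht

/-- Derivative of the marginal rate of substitution along a line. -/
lemma hasDerivAt_rate_line (hu : IsUtility u) (hs : IsSharp u) {v : Fin 2 → ℝ} {t : ℝ}
    (hc : c + t • v ∈ posOrthant 2) :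
    HasDerivAt (fun s : ℝ => rate u (c + s • v))
      (((hessian u (c + t • v)).mulVec v 0 * grad u (c + t • v) 1 -
        grad u (c + t • v) 0 * (hessian u (c + t • v)).mulVec v 1) / grad u (c + t • v) 1 ^ 2)
      t :=
  (hu.hasDerivAt_grad_line hc 0).div (hu.hasDerivAt_grad_line hc 1) (hs.grad_pos hu hc 1).ne'

/-- From an intermediate point the remaining trade is `(1 - t)` times the original one.
Attractiveness there is the quotient rule for the rate, up to positive factors. -/
lemma IsAttractive.mul_deriv_nonpos (hu : IsUtility u) (hs : IsSharp u) (ha : IsAttractive u)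
    (hc : c ∈ posOrthant 2) (hq : 0 < q) {t : ℝ} (ht : t ∈ Set.Ioo (0 : ℝ) 1) :
    (rate u (c + t • (target u c q - c)) - q) *
      deriv (fun s : ℝ => rate u (c + s • (target u c q - c))) t ≤ 0 := by
  have hct := target_path_mem hu hc hq (Set.Ioo_subset_Icc_self ht)
  rw [(hasDerivAt_rate_line hu hs hct).deriv]
  have h := ha _ hct _ (pair_mem_posOrthant hq) 0 1
  rw [normalizedDemand_inv_smul (pair_dotProduct_pos hq hct), ← target,
    target_sub_trade hu hc hq, inverseDemand_div hu hs hct, Matrix.mulVec_smul,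
    dotProduct_smul, sub_dotProduct, smul_dotProduct, smul_dotProduct,
    single_one_dotProduct, single_one_dotProduct] at h
  have hk := inverseDemand_factor_pos hu hs hct
  have hg := hs.grad_pos hu hct 1
  set e := c + t • (target u c q - c)
  set v := target u c q - c
  simp only [inverseDemand, Pi.smul_apply, smul_eq_mul, Matrix.cons_val_zero,
    Matrix.cons_val_one, div_one] at h
  have h1 : 0 < (1 - t) * (grad u e ⬝ᵥ e)⁻¹ := mul_pos (sub_pos.mpr ht.2) hk
  have h2 : (rate u e - q) * ((hessian u e).mulVec v 0 * grad u e 1 -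
      grad u e 0 * (hessian u e).mulVec v 1) ≤ 0 := by
    refine nonpos_of_mul_nonpos_right (a := (1 - t) * (grad u e ⬝ᵥ e)⁻¹) ?_ h1
    linarith
  rw [← mul_div_assoc]
  exact div_nonpos_of_nonpos_of_nonneg h2 (sq_nonneg _)

/-- Trading towards the demand at price `q` moves the marginal rate of substitution towards `q`,
without overshooting. -/
lemma rate_trade_mem (hu : IsUtility u) (hs : IsSharp u) (ha : IsAttractive u)
    (hc : c ∈ posOrthant 2) (hq : 0 < q) {t : ℝ} (ht : t ∈ Set.Icc (0 : ℝ) 1) :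
    rate u (c + t • (target u c q - c)) ∈ Set.uIcc q (rate u c) := by
  set v := target u c q - c with hv
  set φ : ℝ → ℝ := fun s => rate u (c + s • v) with hφ
  have hd : ∀ s ∈ Set.Icc (0 : ℝ) 1, DifferentiableAt ℝ φ s := fun s hs' =>
    (hasDerivAt_rate_line hu hs (target_path_mem hu hc hq hs')).differentiableAt
  -- The distance to `q` decreases; this alone does not exclude jumping to the other side of `q`.
  have hanti : AntitoneOn (fun s => (φ s - q) ^ 2) (Set.Icc 0 1) := by
    refine antitoneOn_of_deriv_nonpos (convex_Icc 0 1) (fun s hs' => ?_) (fun s hs' => ?_)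
      fun s hs' => ?_
    · exact (((hd s hs').sub_const q).pow 2).continuousAt.continuousWithinAt
    · exact (((hd s (interior_subset hs')).sub_const q).pow 2).differentiableWithinAt
    · have hD := (((hd s (interior_subset hs')).hasDerivAt.sub_const q).pow 2).deriv
      rw [interior_Icc] at hs'
      have h := ha.mul_deriv_nonpos hu hs hc hq hs'
      have hD' : deriv (fun s => (φ s - q) ^ 2) s = 2 * ((φ s - q) * deriv φ s) := by
        refine hD.trans ?_
        norm_num
        ring
      rw [hD']
      linarith
  have hφ0 : φ 0 = rate u c := by simp [hφ]
  have hsq : (φ t - q) ^ 2 ≤ (rate u c - q) ^ 2 := by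
    have := hanti (Set.left_mem_Icc.mpr zero_le_one) ht ht.1
    simpa only [hφ0] using this
  -- No overshooting: before `t = 1` the remaining trade keeps the sign of `v 0`, so sharpness at
  -- the intermediate point fixes the sign of `φ t - q`.
  have hsign : 0 ≤ (rate u c - q) * (φ t - q) := by
    rcases ht.2.eq_or_lt with h1 | h1
    · have : φ t = q := by
        rw [hφ, h1]
        simp only [one_smul, hv, add_sub_cancel]
        exact rate_target hu hs hc hq
      simp [this]
    have hct := target_path_mem hu hc hq ht
    have h1' := sub_pos.mpr h1
    have hpt := rate_sub_mul_target_nonneg hu hs hct hq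
    rw [target_sub_trade hu hc hq] at hpt
    simp only [Pi.smul_apply, smul_eq_mul] at hpt
    have hpt' : 0 ≤ (φ t - q) * v 0 := by
      refine nonneg_of_mul_nonneg_right (a := 1 - t) ?_ h1'
      simp only [hφ, hv]
      linarith
    rcases lt_trichotomy (rate u c) q with h | h | h
    · have hv0 := target_lt hu hs hc hq h
      exact mul_nonneg_of_nonpos_of_nonpos (sub_neg.mpr h).le
        (nonpos_of_mul_nonneg_left hpt' hv0)
    · simp [h]
    · have hv0 := lt_target hu hs hc hq h
      exact mul_nonneg (sub_pos.mpr h).le (nonneg_of_mul_nonneg_left hpt' hv0)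
  rw [Set.mem_uIcc]
  rcases le_total q (rate u c) with h | h
  · left
    have := abs_le_of_sq_le_sq' hsq (sub_nonneg.mpr h)
    refine ⟨?_, by linarith⟩
    by_contra hlt
    have h0 := nonneg_of_mul_nonneg_right (a := rate u c - q) hsign
    rcases h.eq_or_lt with h' | h'
    · rw [← h'] at hsq
      have : (φ t - q) ^ 2 ≤ 0 := by simpa using hsq
      nlinarith [not_le.mp hlt]
    · linarith [h0 (sub_pos.mpr h')]
  · right
    have hsq' : (q - φ t) ^ 2 ≤ (q - rate u c) ^ 2 := by nlinarith
    have := abs_le_of_sq_le_sq' hsq' (sub_nonneg.mpr h)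
    refine ⟨by linarith, ?_⟩
    by_contra hlt
    rcases h.eq_or_lt with h' | h'
    · rw [h'] at hsq
      have : (φ t - q) ^ 2 ≤ 0 := by simpa using hsq
      nlinarith [not_le.mp hlt]
    · nlinarith [not_le.mp hlt]

end TwoGoods

/-! ### Two households: trade-compatible prices and one round of trade -/

section Economy

variable {u : Fin 2 → (Fin 2 → ℝ) → ℝ} {z : Fin 2 → Fin 2 → ℝ}

lemma priceOf_eq (q : Fin 1 → ℝ) : priceOf q = ![q 0, 1] := by
  ext i
  fin_cases i <;> simp [priceOf, Fin.snoc]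

/-- The smaller of the two marginal rates of substitution. -/
noncomputable def minRate (u : Fin 2 → (Fin 2 → ℝ) → ℝ) (z : Fin 2 → Fin 2 → ℝ) : ℝ :=
  min (rate (u 0) (z 0)) (rate (u 1) (z 1))

/-- The larger of the two marginal rates of substitution. -/
noncomputable def maxRate (u : Fin 2 → (Fin 2 → ℝ) → ℝ) (z : Fin 2 → Fin 2 → ℝ) : ℝ :=
  max (rate (u 0) (z 0)) (rate (u 1) (z 1))

lemma minRate_le (u : Fin 2 → (Fin 2 → ℝ) → ℝ) (z : Fin 2 → Fin 2 → ℝ) (h : Fin 2) :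
    minRate u z ≤ rate (u h) (z h) := by
  fin_cases h
  · exact min_le_left _ _
  · exact min_le_right _ _

lemma le_maxRate (u : Fin 2 → (Fin 2 → ℝ) → ℝ) (z : Fin 2 → Fin 2 → ℝ) (h : Fin 2) :
    rate (u h) (z h) ≤ maxRate u z := by
  fin_cases h
  · exact le_max_left _ _
  · exact le_max_right _ _

lemma minRate_le_maxRate (u : Fin 2 → (Fin 2 → ℝ) → ℝ) (z : Fin 2 → Fin 2 → ℝ) :
    minRate u z ≤ maxRate u z := (minRate_le u z 0).trans (le_maxRate u z 0)

lemma deriv_linearTradePath_pair {v : (Fin 2 → ℝ) → ℝ} {c : Fin 2 → ℝ} {q : Fin 1 → ℝ}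
    (hc : c ∈ posOrthant 2) (hq : 0 < q 0) :
    deriv (linearTradePath v c (priceOf q)) 0 = target v c (q 0) - c := by
  rw [priceOf_eq, deriv_linearTradePath (pair_dotProduct_pos hq hc), ← target]

/-- Trade at a price is possible if and only if the two households want opposite trades. -/
lemma tradeSpeeds_nonempty_iff (hu : ∀ h, IsUtility (u h)) (hz : z ∈ allocations 2 2)
    {q : Fin 1 → ℝ} (hq : 0 < q 0) :
    (tradeSpeeds u z (priceOf q)).Nonempty ↔
      (target (u 0) (z 0) (q 0) - z 0) 0 * (target (u 1) (z 1) (q 0) - z 1) 0 < 0 := by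
  have e0 := target_sub_one (hu 0) (hz 0) hq
  have e1 := target_sub_one (hu 1) (hz 1) hq
  simp only [tradeSpeeds, Fin.sum_univ_two, deriv_linearTradePath_pair (hz _) hq]
  set v := target (u 0) (z 0) (q 0) - z 0
  set w := target (u 1) (z 1) (q 0) - z 1
  -- By budget balance, clearing the market for good 0 clears the other one.
  have key : ∀ a b : ℝ, a * v 0 + b * w 0 = 0 → a • v + b • w = 0 := by
    intro a b h
    ext i
    fin_cases i
    · simpa using h
    · simp [e0, e1]
      linear_combination (-q 0) * h
  constructor
  · rintro ⟨σ, hσ, hsum, hpos⟩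
    by_contra hge
    push Not at hge
    have h0 : σ 0 * v 0 + σ 1 * w 0 = 0 := by simpa using congrFun hsum 0
    have hs0 := (hσ 0).1
    have hs1 := (hσ 1).1
    -- Multiply market clearing by `σ 0 * v 0`: when the desired trades do not have opposite signs,
    -- the square is nonpositive. Both trades then vanish, against the positivity of total trade.
    have h1 : σ 0 * v 0 = 0 := by
      have : (σ 0 * v 0) ^ 2 ≤ 0 := by
        have h2 : (σ 0 * v 0) ^ 2 = -(σ 0 * σ 1 * (v 0 * w 0)) := by
          linear_combination (σ 0 * v 0) * h0
        rw [h2]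
        have := mul_nonneg (mul_nonneg hs0 hs1) hge
        linarith
      exact pow_eq_zero_iff two_ne_zero |>.mp (le_antisymm this (sq_nonneg _))
    have hv : σ 0 • v = 0 := by simpa using key (σ 0) 0 (by simpa using h1)
    have hw : σ 1 • w = 0 := by
      rw [hv, zero_add] at hsum
      exact hsum
    have hv' := congrArg norm hv
    have hw' := congrArg norm hw
    rw [norm_smul, Real.norm_of_nonneg hs0, norm_zero] at hv'
    rw [norm_smul, Real.norm_of_nonneg hs1, norm_zero] at hw'
    linarith
  · intro hneg
    have hne : v 0 - w 0 ≠ 0 := fun h => by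
      rw [sub_eq_zero.mp h] at hneg
      nlinarith [mul_self_nonneg (w 0)]
    -- The balancing weights `-w 0` and `v 0`, normalized to sum to one so that they lie in the unit
    -- interval.
    have hab : 0 < -w 0 / (v 0 - w 0) ∧ 0 < v 0 / (v 0 - w 0) := by
      rcases mul_neg_iff.mp hneg with ⟨h1, h2⟩ | ⟨h1, h2⟩
      · exact ⟨div_pos (by linarith) (by linarith), div_pos h1 (by linarith)⟩
      · exact ⟨div_pos_of_neg_of_neg (by linarith) (by linarith),
          div_pos_of_neg_of_neg h1 (by linarith)⟩
    have hone : -w 0 / (v 0 - w 0) + v 0 / (v 0 - w 0) = 1 := by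
      rw [← add_div, neg_add_eq_sub, div_self hne]
    refine ⟨![-w 0 / (v 0 - w 0), v 0 / (v 0 - w 0)], fun h => ?_, ?_, ?_⟩
    · fin_cases h
      · exact ⟨hab.1.le, by simp; linarith [hab.2]⟩
      · exact ⟨hab.2.le, by simp; linarith [hab.1]⟩
    · refine key _ _ ?_
      simp only [Matrix.cons_val_zero, Matrix.cons_val_one]
      field_simp
      ring
    · have hv0 : v ≠ 0 := fun h => by simp [h] at hneg
      exact add_pos_of_pos_of_nonneg (mul_pos hab.1 (norm_pos_iff.mpr hv0))
        (mul_nonneg hab.2.le (norm_nonneg _))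

/-- Trade is possible at the prices strictly between the two marginal rates of substitution. -/
lemma mem_tradePrices_iff (hu : ∀ h, IsUtility (u h)) (hs : ∀ h, IsSharp (u h))
    (hz : z ∈ allocations 2 2) (q : Fin 1 → ℝ) :
    q ∈ tradePrices u z ↔ minRate u z < q 0 ∧ q 0 < maxRate u z := by
  have r0 := rate_pos (hu 0) (hs 0) (hz 0)
  have r1 := rate_pos (hu 1) (hs 1) (hz 1)
  constructor
  · rintro ⟨hq, hne⟩
    have hq0 : 0 < q 0 := hq 0
    rw [tradeSpeeds_nonempty_iff hu hz hq0] at hne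
    have m0 := rate_sub_mul_target_nonneg (hu 0) (hs 0) (hz 0) hq0
    have m1 := rate_sub_mul_target_nonneg (hu 1) (hs 1) (hz 1) hq0
    have n0 : rate (u 0) (z 0) ≠ q 0 := fun h => by
      rw [← h, target_eq_self (hu 0) (hs 0) (hz 0)] at hne
      simp at hne
    have n1 : rate (u 1) (z 1) ≠ q 0 := fun h => by
      rw [← h, target_eq_self (hu 1) (hs 1) (hz 1)] at hne
      simp at hne
    rw [minRate, maxRate, min_lt_iff, lt_max_iff]
    rcases mul_neg_iff.mp hne with ⟨h1, h2⟩ | ⟨h1, h2⟩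
    · have a0 := nonneg_of_mul_nonneg_left m0 h1
      have a1 := nonpos_of_mul_nonneg_left m1 h2
      exact ⟨Or.inr (lt_of_le_of_ne (by linarith) n1),
        Or.inl (lt_of_le_of_ne (by linarith) n0.symm)⟩
    · have a0 := nonpos_of_mul_nonneg_left m0 h1
      have a1 := nonneg_of_mul_nonneg_left m1 h2
      exact ⟨Or.inl (lt_of_le_of_ne (by linarith) n0),
        Or.inr (lt_of_le_of_ne (by linarith) n1.symm)⟩
  · rintro ⟨h1, h2⟩
    have hq0 : 0 < q 0 := (lt_min r0 r1).trans h1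
    refine ⟨fun i => by rwa [Subsingleton.elim i 0], ?_⟩
    rw [tradeSpeeds_nonempty_iff hu hz hq0]
    rw [minRate, min_lt_iff] at h1
    rw [maxRate, lt_max_iff] at h2
    have c : (rate (u 0) (z 0) < q 0 ∧ q 0 < rate (u 1) (z 1)) ∨
        (rate (u 1) (z 1) < q 0 ∧ q 0 < rate (u 0) (z 0)) := by
      rcases h1 with h1 | h1 <;> rcases h2 with h2 | h2
      · exact absurd h1 h2.not_gt
      · exact Or.inl ⟨h1, h2⟩
      · exact Or.inr ⟨h1, h2⟩
      · exact absurd h1 h2.not_gt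
    rcases c with ⟨a, b⟩ | ⟨a, b⟩
    · exact mul_neg_of_neg_of_pos (target_lt (hu 0) (hs 0) (hz 0) hq0 a)
        (lt_target (hu 1) (hs 1) (hz 1) hq0 b)
    · exact mul_neg_of_pos_of_neg (lt_target (hu 0) (hs 0) (hz 0) hq0 b)
        (target_lt (hu 1) (hs 1) (hz 1) hq0 a)

lemma tradePrices_nonempty_iff (hu : ∀ h, IsUtility (u h)) (hs : ∀ h, IsSharp (u h))
    (hz : z ∈ allocations 2 2) : (tradePrices u z).Nonempty ↔ minRate u z < maxRate u z := by
  constructor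
  · rintro ⟨q, hq⟩
    rw [mem_tradePrices_iff hu hs hz] at hq
    exact hq.1.trans hq.2
  · intro h
    obtain ⟨q, hq⟩ := exists_between h
    exact ⟨fun _ => q, (mem_tradePrices_iff hu hs hz _).mpr hq⟩

lemma tradePrices_eq (hu : ∀ h, IsUtility (u h)) (hs : ∀ h, IsSharp (u h))
    (hz : z ∈ allocations 2 2) :
    tradePrices u z = (fun q : Fin 1 → ℝ => q 0) ⁻¹' Set.Ioo (minRate u z) (maxRate u z) :=
  Set.ext fun q => mem_tradePrices_iff hu hs hz q

/-- The effect of one round of trade in which some household trades at full speed. -/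
structure IsImprovement (u : Fin 2 → (Fin 2 → ℝ) → ℝ) (z z' : Fin 2 → Fin 2 → ℝ) : Prop where
  sum_eq : ∑ h, z' h = ∑ h, z h
  utility_le : ∀ h, u h (z h) ≤ u h (z' h)
  minRate_le : minRate u z ≤ minRate u z'
  maxRate_le : maxRate u z' ≤ maxRate u z

lemma IsImprovement.refl (u : Fin 2 → (Fin 2 → ℝ) → ℝ) (z : Fin 2 → Fin 2 → ℝ) :
    IsImprovement u z z := ⟨rfl, fun _ => le_rfl, le_rfl, le_rfl⟩

lemma jointTradePath_pair {q : Fin 1 → ℝ} (hz : z ∈ allocations 2 2) (hq : 0 < q 0)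
    (σ : Fin 2 → ℝ) (h : Fin 2) :
    jointTradePath u z (priceOf q) σ 1 h = z h + σ h • (target (u h) (z h) (q 0) - z h) := by
  rw [jointTradePath, priceOf_eq, linearTradePath_eq (pair_dotProduct_pos hq (hz h)), mul_one,
    ← target]

/-- Each new rate lies between the old one and `q`, and `q` lies between the two old rates. -/
lemma isImprovement_trade (hu : ∀ h, IsUtility (u h)) (hs : ∀ h, IsSharp (u h))
    (ha : ∀ h, IsAttractive (u h)) (hz : z ∈ allocations 2 2) {q : Fin 1 → ℝ}
    (hq : q ∈ tradePrices u z) {σ : Fin 2 → ℝ} (hσ : σ ∈ tradeSpeeds u z (priceOf q)) :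
    IsImprovement u z (jointTradePath u z (priceOf q) σ 1) := by
  have hq0 : 0 < q 0 := hq.1 0
  obtain ⟨hq1, hq2⟩ := (mem_tradePrices_iff hu hs hz q).mp hq
  have hmem : ∀ h, rate (u h) (jointTradePath u z (priceOf q) σ 1 h) ∈
      Set.uIcc (q 0) (rate (u h) (z h)) := fun h => by
    rw [jointTradePath_pair hz hq0]
    exact rate_trade_mem (hu h) (hs h) (ha h) (hz h) hq0 (hσ.1 h)
  have hI : ∀ h, minRate u z ≤ rate (u h) (jointTradePath u z (priceOf q) σ 1 h) ∧
      rate (u h) (jointTradePath u z (priceOf q) σ 1 h) ≤ maxRate u z := fun h =>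
    ⟨(le_min hq1.le (minRate_le u z h)).trans (hmem h).1,
      (hmem h).2.trans (max_le hq2.le (le_maxRate u z h))⟩
  refine ⟨?_, fun h => ?_, le_min (hI 0).1 (hI 1).1, max_le (hI 0).2 (hI 1).2⟩
  · have h2 := hσ.2.1
    simp only [deriv_linearTradePath_pair (hz _) hq0] at h2
    simp only [jointTradePath_pair hz hq0, Finset.sum_add_distrib, h2, add_zero]
  · rw [jointTradePath_pair hz hq0]
    exact (hu h).le_of_trade (pair_mem_posOrthant hq0) (hz h) (pair_dotProduct_pos hq0 (hz h))
      (hσ.1 h)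

/-- After trade at full speed, the trading price is no longer compatible with trade. -/
lemma not_mem_tradePrices_trade (hu : ∀ h, IsUtility (u h)) (hs : ∀ h, IsSharp (u h))
    (hz : z ∈ allocations 2 2) {q : Fin 1 → ℝ} (hq : q ∈ tradePrices u z) {σ : Fin 2 → ℝ}
    (hσ : σ ∈ tradeSpeeds u z (priceOf q)) (hn : ‖σ‖ = 1)
    (hz' : jointTradePath u z (priceOf q) σ 1 ∈ allocations 2 2) :
    q ∉ tradePrices u (jointTradePath u z (priceOf q) σ 1) := by
  have hq0 : 0 < q 0 := hq.1 0
  -- The sup norm is attained, so some household trades all the way to its demand. It then wants no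
  -- further trade at `q`.
  obtain ⟨h, hh⟩ : ∃ h, σ h = 1 := by
    by_contra hne
    push Not at hne
    have : ‖σ‖ < 1 := (pi_norm_lt_iff one_pos).mpr fun h => by
      rw [Real.norm_of_nonneg (hσ.1 h).1]
      exact lt_of_le_of_ne (hσ.1 h).2 (hne h)
    linarith
  have hr : rate (u h) (jointTradePath u z (priceOf q) σ 1 h) = q 0 := by
    rw [jointTradePath_pair hz hq0, hh, one_smul, add_sub_cancel]
    exact rate_target (hu h) (hs h) (hz h) hq0
  set z' := jointTradePath u z (priceOf q) σ 1
  rintro ⟨-, hne⟩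
  rw [tradeSpeeds_nonempty_iff hu hz' hq0] at hne
  have hself := target_eq_self (hu h) (hs h) (hz' h)
  rw [hr] at hself
  fin_cases h <;> simp only [Fin.zero_eta, Fin.mk_one] at hself <;> rw [hself] at hne <;>
    simp at hne

lemma continuousOn_rate {v : (Fin 2 → ℝ) → ℝ} (hu : IsUtility v) (hs : IsSharp v) :
    ContinuousOn (rate v) (posOrthant 2) := fun _ hc =>
  ((hu.differentiableAt_grad hc 0).continuousAt.div (hu.differentiableAt_grad hc 1).continuousAt
    (hs.grad_pos hu hc 1).ne').continuousWithinAt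

lemma isOpen_allocations (H L : ℕ) : IsOpen (allocations H L) := by
  have : allocations H L = ⋂ h, {z | z h ∈ posOrthant L} := by ext; simp [allocations]
  rw [this]
  exact isOpen_iInter_of_finite fun h => isOpen_posOrthant.preimage (continuous_apply h)

lemma continuousOn_rate_apply (hu : ∀ h, IsUtility (u h)) (hs : ∀ h, IsSharp (u h)) (h : Fin 2) :
    ContinuousOn (fun z : Fin 2 → Fin 2 → ℝ => rate (u h) (z h)) (allocations 2 2) :=
  (continuousOn_rate (hu h) (hs h)).comp (continuous_apply h).continuousOn fun _ hz => hz h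

/-- The allocations at which all prices in `(a,b)` are compatible with trade. -/
def tradingAt (u : Fin 2 → (Fin 2 → ℝ) → ℝ) (a b : ℝ) : Set (Fin 2 → Fin 2 → ℝ) :=
  {z | z ∈ allocations 2 2 ∧ minRate u z ≤ a ∧ b ≤ maxRate u z}

/-- The rates are continuous only on the open set of allocations, so the set is obtained by removing
two relatively open sets. Measurability makes `Y t ⁻¹' tradingAt u a b` an event over which
conditional probabilities integrate. -/
lemma measurableSet_tradingAt (hu : ∀ h, IsUtility (u h)) (hs : ∀ h, IsSharp (u h)) (a b : ℝ) :
    MeasurableSet (tradingAt u a b) := by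
  have hmin : ContinuousOn (minRate u) (allocations 2 2) :=
    ContinuousOn.inf (continuousOn_rate_apply hu hs 0) (continuousOn_rate_apply hu hs 1)
  have hmax : ContinuousOn (maxRate u) (allocations 2 2) :=
    ContinuousOn.sup (continuousOn_rate_apply hu hs 0) (continuousOn_rate_apply hu hs 1)
  have ho := isOpen_allocations 2 2
  have : tradingAt u a b = (allocations 2 2 \ (allocations 2 2 ∩ minRate u ⁻¹' Set.Ioi a)) \
      (allocations 2 2 ∩ maxRate u ⁻¹' Set.Iio b) := by
    ext z
    simp only [tradingAt, Set.mem_ofPred_eq, Set.mem_sdiff, Set.mem_inter_iff, Set.mem_preimage,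
      Set.mem_Ioi, Set.mem_Iio, not_and, not_lt]
    tauto
  rw [this]
  exact (ho.measurableSet.diff (hmin.isOpen_inter_preimage ho isOpen_Ioi).measurableSet).diff
    (hmax.isOpen_inter_preimage ho isOpen_Iio).measurableSet

end Economy

/-! ### The stochastic process: price intervals do not survive -/

section Dynamics

variable {Ω : Type*} [MeasurableSpace Ω] {P : Measure Ω}
  {u : Fin 2 → (Fin 2 → ℝ) → ℝ} {y : Fin 2 → Fin 2 → ℝ}
  {Y : ℕ → Ω → Fin 2 → Fin 2 → ℝ} {Q : ℕ → Ω → Fin 1 → ℝ} {S : ℕ → Ω → Fin 2 → ℝ}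
  {fQ : (Fin 1 → ℝ) → ℝ} {fS : (Fin 2 → ℝ) → ℝ}

lemma IsSNTP.ae_isImprovement (hu : ∀ h, IsUtility (u h)) (hs : ∀ h, IsSharp (u h))
    (ha : ∀ h, IsAttractive (u h)) (hY : IsSNTP (n := 1) u y P Y Q S) :
    ∀ᵐ ω ∂P, ∀ t, IsImprovement u (Y t ω) (Y (t + 1) ω) := by
  filter_upwards [hY.trade, hY.rest] with ω htrade hrest t
  rcases (tradePrices u (Y t ω)).eq_empty_or_nonempty with he | hne
  · rw [(hrest t he).2.2]
    exact IsImprovement.refl _ _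
  · obtain ⟨h1, h2, h3⟩ := htrade t hne
    rw [h3]
    exact isImprovement_trade hu hs ha (hY.state t ω) h1 h2

lemma IsSNTP.ae_price (hu : ∀ h, IsUtility (u h)) (hs : ∀ h, IsSharp (u h))
    (hY : IsSNTP (n := 1) u y P Y Q S)
    (hspeed : ∀ t, ∀ᵐ ω ∂P, (tradePrices u (Y t ω)).Nonempty → ‖S (t + 1) ω‖ = 1) :
    ∀ᵐ ω ∂P, ∀ t, (tradePrices u (Y t ω)).Nonempty →
      Q (t + 1) ω ∉ tradePrices u (Y (t + 1) ω) := by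
  filter_upwards [hY.trade, ae_all_iff.mpr hspeed] with ω htrade hsp t hne
  obtain ⟨h1, h2, h3⟩ := htrade t hne
  rw [h3]
  exact not_mem_tradePrices_trade hu hs (hY.state t ω) h1 h2 (hsp t hne)
    (h3 ▸ hY.state (t + 1) ω)

lemma measurableSet_priceInterval (a b : ℝ) :
    MeasurableSet ((fun q : Fin 1 → ℝ => q 0) ⁻¹' Set.Ioo a b) :=
  measurableSet_Ioo.preimage (measurable_pi_apply 0)

lemma priceInterval_subset_tradePrices (hu : ∀ h, IsUtility (u h)) (hs : ∀ h, IsSharp (u h))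
    {z : Fin 2 → Fin 2 → ℝ} {a b : ℝ} (hz : z ∈ tradingAt u a b) :
    (fun q : Fin 1 → ℝ => q 0) ⁻¹' Set.Ioo a b ⊆ tradePrices u z := by
  rw [tradePrices_eq hu hs hz.1]
  exact Set.preimage_mono (Set.Ioo_subset_Ioo hz.2.1 hz.2.2)

lemma setIntegral_priceInterval_pos {a b : ℝ} (hab : a < b) (hint : Integrable fQ)
    (hf : ∀ q : Fin 1 → ℝ, q 0 ∈ Set.Ioo a b → 0 < fQ q) :
    0 < ∫ q in (fun q : Fin 1 → ℝ => q 0) ⁻¹' Set.Ioo a b, fQ q := by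
  have hm := measurableSet_priceInterval a b
  rw [setIntegral_pos_iff_support_of_nonneg_ae
    ((ae_restrict_mem hm).mono fun q hq => (hf q hq).le) hint.integrableOn]
  have hsub : (fun q : Fin 1 → ℝ => q 0) ⁻¹' Set.Ioo a b ⊆
      Function.support fQ ∩ (fun q : Fin 1 → ℝ => q 0) ⁻¹' Set.Ioo a b :=
    fun q hq => ⟨(hf q hq).ne', hq⟩
  refine lt_of_lt_of_le ?_ (measure_mono hsub)
  obtain ⟨c, hc⟩ := exists_between hab
  exact (isOpen_Ioo.preimage (continuous_apply 0)).measure_pos volume ⟨fun _ => c, hc⟩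

/-- The price falls into a set of trade-compatible prices with at least its prior probability. -/
lemma IsBSNTP.le_prob_price [IsProbabilityMeasure P]
    (hu : ∀ h, IsUtility (u h)) (hs : ∀ h, IsSharp (u h))
    (hY : IsBSNTP (n := 1) u y P Y Q S fQ fS) {a b : ℝ}
    (hpos : 0 < ∫ q in (fun q : Fin 1 → ℝ => q 0) ⁻¹' Set.Ioo a b, fQ q) (t : ℕ) :
    (∫ q in (fun q : Fin 1 → ℝ => q 0) ⁻¹' Set.Ioo a b, fQ q) *
        P.real (Y t ⁻¹' tradingAt u a b) ≤
      P.real (Y t ⁻¹' tradingAt u a b ∩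
        Q (t + 1) ⁻¹' ((fun q : Fin 1 → ℝ => q 0) ⁻¹' Set.Ioo a b)) := by
  set A := (fun q : Fin 1 → ℝ => q 0) ⁻¹' Set.Ioo a b with hA
  set ε := ∫ q in A, fQ q with hε
  have hAm : MeasurableSet A := measurableSet_priceInterval a b
  have hQA : MeasurableSet (Q (t + 1) ⁻¹' A) := hY.measurable_Q _ hAm
  have hm := (hY.measurable_Y t).comap_le
  have hE : MeasurableSet[MeasurableSpace.comap (Y t) inferInstance] (Y t ⁻¹' tradingAt u a b) :=
    ⟨_, measurableSet_tradingAt hu hs a b, rfl⟩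
  have hind : Integrable ((Q (t + 1) ⁻¹' A).indicator fun _ => (1 : ℝ)) P :=
    (integrable_const 1).indicator hQA
  have h1 := setIntegral_condExp hm hind hE
  rw [setIntegral_indicator hQA, setIntegral_const, smul_eq_mul, mul_one] at h1
  rw [← h1, mul_comm, ← smul_eq_mul, ← setIntegral_const]
  refine setIntegral_mono_on_ae (integrable_const _).integrableOn
    integrable_condExp.integrableOn (hm _ hE) ?_
  filter_upwards [hY.bayes_Q t A hAm] with ω hω hωE
  have hsub : A ⊆ tradePrices u (Y t ω) := priceInterval_subset_tradePrices hu hs hωE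
  have hle : ε ≤ ∫ q in tradePrices u (Y t ω), fQ q :=
    setIntegral_mono_set hY.fQ_integrable.integrableOn
      (Eventually.of_forall hY.fQ_nonneg) hsub.eventuallyLE
  have hle1 : ∫ q in tradePrices u (Y t ω), fQ q ≤ 1 := by
    rw [← hY.fQ_integral]
    exact setIntegral_le_integral hY.fQ_integrable (Eventually.of_forall hY.fQ_nonneg)
  have hD := hpos.trans_le hle
  -- On this event the Bayes quotient is `ε` divided by a number in `(0, 1]`, hence at least `ε`.
  rw [hω hD, Set.inter_eq_self_of_subset_right hsub, le_div_iff₀ hD]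
  nlinarith

/-- Almost surely, no nontrivial interval of prices stays compatible with trade forever. -/
lemma IsBSNTP.ae_not_forall_tradingAt [IsProbabilityMeasure P]
    (hu : ∀ h, IsUtility (u h)) (hs : ∀ h, IsSharp (u h)) (ha : ∀ h, IsAttractive (u h))
    (hY : IsBSNTP (n := 1) u y P Y Q S fQ fS)
    (hfQ : ∀ q ∈ tradePrices (n := 1) u y, 0 < fQ q)
    (hspeed : ∀ t, ∀ᵐ ω ∂P, (tradePrices u (Y t ω)).Nonempty → ‖S (t + 1) ω‖ = 1)
    {a b : ℝ} (hab : a < b) :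
    ∀ᵐ ω ∂P, ¬ ∀ t, Y t ω ∈ tradingAt u a b := by
  -- The prior is known to be positive only on the prices compatible with `y`; an interval not
  -- available at the start is excluded at time `0`.
  by_cases hy : y ∈ tradingAt u a b
  swap
  · filter_upwards [hY.start] with ω hω h
    exact hy (hω ▸ h 0)
  set A := (fun q : Fin 1 → ℝ => q 0) ⁻¹' Set.Ioo a b with hA
  set ε := ∫ q in A, fQ q with hε
  have hpos : 0 < ε := setIntegral_priceInterval_pos hab hY.fQ_integrable fun q hq =>
    hfQ q (priceInterval_subset_tradePrices hu hs hy hq)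
  have hle1 : ε ≤ 1 := by
    rw [← hY.fQ_integral]
    exact setIntegral_le_integral hY.fQ_integrable (Eventually.of_forall hY.fQ_nonneg)
  have hstep : ∀ t, P.real (Y (t + 1) ⁻¹' tradingAt u a b) ≤
      (1 - ε) * P.real (Y t ⁻¹' tradingAt u a b) := fun t => by
    have hQA : MeasurableSet (Q (t + 1) ⁻¹' A) :=
      hY.measurable_Q _ (measurableSet_priceInterval a b)
    -- If the interval is available after the round, it was available before by nestedness, and the
    -- price was not in it, since the trading price drops out.
    have hsub : P.real (Y (t + 1) ⁻¹' tradingAt u a b) ≤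
        P.real (Y t ⁻¹' tradingAt u a b \ Q (t + 1) ⁻¹' A) := by
      refine ENNReal.toReal_mono (measure_ne_top _ _) (measure_mono_ae ?_)
      filter_upwards [hY.toIsSNTP.ae_isImprovement hu hs ha, hY.toIsSNTP.ae_price hu hs hspeed]
        with ω himp hprice hω
      have hω' : Y (t + 1) ω ∈ tradingAt u a b := hω
      have hE : Y t ω ∈ tradingAt u a b := ⟨hY.state t ω,
        (himp t).minRate_le.trans hω'.2.1, hω'.2.2.trans (himp t).maxRate_le⟩
      refine ⟨hE, fun hq => hprice t ?_ (priceInterval_subset_tradePrices hu hs hω' hq)⟩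
      rw [tradePrices_nonempty_iff hu hs (hY.state t ω)]
      exact hE.2.1.trans_lt (hab.trans_le hE.2.2)
    have h2 := hY.le_prob_price hu hs hpos t
    have h3 := measureReal_sdiff_add_inter (μ := P) (s := Y t ⁻¹' tradingAt u a b) hQA
    linarith
  have hpow : ∀ t, P.real (Y t ⁻¹' tradingAt u a b) ≤ (1 - ε) ^ t := fun t => by
    induction t with
    | zero => simp
    | succ t ih =>
      rw [pow_succ']
      exact (hstep t).trans (mul_le_mul_of_nonneg_left ih (by linarith))
  have hlim : Tendsto (fun t : ℕ => (1 - ε) ^ t) atTop (𝓝 0) :=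
    tendsto_pow_atTop_nhds_zero_of_lt_one (by linarith) (by linarith)
  have hzero : P.real {ω | ∀ t, Y t ω ∈ tradingAt u a b} ≤ 0 :=
    ge_of_tendsto' hlim fun t =>
      (measureReal_mono (s₁ := {ω | ∀ t, Y t ω ∈ tradingAt u a b}) fun _ hω => hω t).trans
        (hpow t)
  rw [ae_iff]
  simp only [not_not]
  exact (measureReal_eq_zero_iff).mp (le_antisymm hzero measureReal_nonneg)

end Dynamics

/-! ### Convergence of a single path -/

section Limit

variable {u : Fin 2 → (Fin 2 → ℝ) → ℝ}

lemma isCompact_feasible (e : Fin 2 → ℝ) :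
    IsCompact {z : Fin 2 → Fin 2 → ℝ | (∀ h, z h ∈ nonnegOrthant 2) ∧ ∑ h, z h = e} := by
  have hc : IsClosed {z : Fin 2 → Fin 2 → ℝ | (∀ h, z h ∈ nonnegOrthant 2) ∧ ∑ h, z h = e} := by
    have h1 : IsClosed {z : Fin 2 → Fin 2 → ℝ | ∀ h, z h ∈ nonnegOrthant 2} := by
      simp only [Set.ofPred_forall]
      exact isClosed_iInter fun h => isClosed_nonnegOrthant.preimage (continuous_apply h)
    exact h1.inter (isClosed_eq (by fun_prop) continuous_const)
  refine (isCompact_Icc (a := (0 : Fin 2 → Fin 2 → ℝ)) (b := fun _ => e)).of_isClosed_subset hc ?_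
  rintro z ⟨hz, hsum⟩
  refine ⟨hz, fun h => ?_⟩
  rw [← hsum]
  exact Finset.single_le_sum (f := z) (fun j _ => hz j) (Finset.mem_univ h)

/-- A sequence of improving allocations whose marginal rates of substitution have no interval in
common converges to a Pareto optimal allocation. -/
lemma exists_tendsto_paretoSet (hu : ∀ h, IsUtility (u h)) (hs : ∀ h, IsSharp (u h))
    {x : ℕ → Fin 2 → Fin 2 → ℝ} (hx : ∀ t, x t ∈ allocations 2 2)
    (himp : ∀ t, IsImprovement u (x t) (x (t + 1)))
    (hgap : ∀ a b : ℚ, a < b → ¬ ∀ t, x t ∈ tradingAt u a b) :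
    ∃ z ∈ paretoSet u, Tendsto x atTop (𝓝 z) := by
  have hlo : Monotone fun t => minRate u (x t) :=
    monotone_nat_of_le_succ fun t => (himp t).minRate_le
  have hhi : Antitone fun t => maxRate u (x t) :=
    antitone_nat_of_succ_le fun t => (himp t).maxRate_le
  have hut : ∀ h, Monotone fun t => u h (x t h) := fun h =>
    monotone_nat_of_le_succ fun t => (himp t).utility_le h
  have hsum : ∀ t, ∑ h, x t h = ∑ h, x 0 h := fun t => by
    induction t with
    | zero => rfl
    | succ t ih => rw [(himp t).sum_eq, ih]
  have hcross : ∀ s t, minRate u (x s) ≤ maxRate u (x t) := fun s t =>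
    (hlo (le_max_left s t)).trans
      ((minRate_le_maxRate u _).trans (hhi (le_max_right s t)))
  have hbl : BddAbove (Set.range fun t => minRate u (x t)) :=
    ⟨_, Set.forall_mem_range.mpr fun s => hcross s 0⟩
  have hbh : BddBelow (Set.range fun t => maxRate u (x t)) :=
    ⟨_, Set.forall_mem_range.mpr fun s => hcross 0 s⟩
  have hla := tendsto_atTop_ciSup hlo hbl
  have hlb := tendsto_atTop_ciInf hhi hbh
  set q := ⨆ t, minRate u (x t) with hq
  -- A gap between the limits would contain a rational interval that stays trade-compatible forever.
  have heq : ⨅ t, maxRate u (x t) = q := by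
    refine le_antisymm (not_lt.mp fun hlt => ?_) (le_of_tendsto_of_tendsto' hla hlb fun t =>
      minRate_le_maxRate u _)
    obtain ⟨a, ha1, ha2⟩ := exists_rat_btwn hlt
    obtain ⟨b, hb1, hb2⟩ := exists_rat_btwn ha2
    exact hgap a b (by exact_mod_cast hb1) fun t => ⟨hx t, (le_ciSup hbl t).trans ha1.le,
      hb2.le.trans (ciInf_le hbh t)⟩
  rw [heq] at hlb
  have hrate : ∀ h, Tendsto (fun t => rate (u h) (x t h)) atTop (𝓝 q) := fun h =>
    tendsto_of_tendsto_of_tendsto_of_le_of_le hla hlb (fun t => minRate_le u _ h)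
      fun t => le_maxRate u _ h
  have hqpos : 0 < q :=
    (lt_min (rate_pos (hu 0) (hs 0) (hx 0 0)) (rate_pos (hu 1) (hs 1) (hx 0 1))).trans_le
      (le_ciSup hbl 0)
  have hpr : ∀ h, Tendsto (fun t => (![rate (u h) (x t h), 1] : Fin 2 → ℝ)) atTop
      (𝓝 ![q, 1]) := fun h => by
    refine tendsto_pi_nhds.mpr fun i => ?_
    fin_cases i
    · simpa using hrate h
    · simp
  -- Every sequence of times has a subsequence along which the allocations converge to an
  -- equilibrium at prices `(q,1)`, weakly better than every allocation on the path.
  have hcluster : ∀ (ns : ℕ → ℕ), Tendsto ns atTop atTop → ∃ z ∈ allocations 2 2,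
      (∀ h, IsDemanded (u h) ![q, 1] (![q, 1] ⬝ᵥ z h) (z h)) ∧ ∑ h, z h = ∑ h, x 0 h ∧
      (∀ h t, u h (x t h) ≤ u h (z h)) ∧
      ∃ ms : ℕ → ℕ, Tendsto ms atTop atTop ∧
        Tendsto (fun k => x (ns (ms k))) atTop (𝓝 z) := fun ns hns => by
    obtain ⟨z, ⟨hz0, hzsum⟩, φ, hφ, hz⟩ := (isCompact_feasible (∑ h, x 0 h)).tendsto_subseq
      (x := fun k => x (ns k))
      fun k => ⟨fun h => posOrthant_subset_nonnegOrthant (hx _ h), hsum _⟩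
    have hn : Tendsto (fun k => ns (φ k)) atTop atTop := hns.comp hφ.tendsto_atTop
    have hzh : ∀ h, Tendsto (fun k => x (ns (φ k)) h) atTop (𝓝 (z h)) :=
      fun h => (tendsto_pi_nhds.mp hz) h
    have hge : ∀ h t, u h (x t h) ≤ u h (z h) := fun h t => by
      refine ge_of_tendsto ((hu h).tendsto (hzh h) (hz0 h)
        (Eventually.of_forall fun k => posOrthant_subset_nonnegOrthant (hx _ h))) ?_
      filter_upwards [hn.eventually_ge_atTop t] with k hk
      exact hut h hk
    -- The limit bundle is at least as good as the initial one, whose utility is positive, so it is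
    -- nonzero and has positive value.
    have hw : ∀ h, 0 < ![q, 1] ⬝ᵥ z h := fun h =>
      dotProduct_pos_of_mem (pair_mem_posOrthant hqpos) (hz0 h) fun h0 => by
        have h1 := (hu h).pos_of_mem_posOrthant (hx 0 h)
        have h2 := hge h 0
        rw [h0, (hu h).map_zero] at h2
        linarith
    have hd : ∀ h, IsDemanded (u h) ![q, 1] (![q, 1] ⬝ᵥ z h) (z h) := fun h =>
      isDemanded_of_tendsto (hu h) (hzh h) ((hpr h).comp hn) (hw h) fun k =>
        isDemanded_rate (hu h) (hs h) (hx _ h)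
    refine ⟨z, fun h => ?_, hd, hzsum, hge, φ, hφ.tendsto_atTop, hz⟩
    rw [(hd h).eq_walrasianDemand (hu h) (pair_mem_posOrthant hqpos) (hw h)]
    exact (hu h).demand_interior _ (pair_mem_posOrthant hqpos) _ (hw h)
  obtain ⟨z, hzpos, hzd, hzsum, -, ms, hms, hz⟩ := hcluster id tendsto_id
  refine ⟨z, mem_paretoSet_of_isDemanded hu hzpos hzd, ?_⟩
  -- It suffices that every cluster point `z'` equals `z`. It is weakly better than `z`, because the
  -- utilities at `z` are limits of path utilities, which those at `z'` bound.
  refine tendsto_of_subseq_tendsto fun ns hns => ?_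
  obtain ⟨z', hz'pos, -, hz'sum, hz'ge, ms', -, hz'⟩ := hcluster ns hns
  have : z' = z := by
    refine eq_of_isDemanded_of_sum_eq hu hzpos hz'pos hzd (fun h => ?_) (hz'sum.trans hzsum.symm)
    exact le_of_tendsto ((hu h).tendsto ((tendsto_pi_nhds.mp hz) h)
      (posOrthant_subset_nonnegOrthant (hzpos h))
      (Eventually.of_forall fun k => posOrthant_subset_nonnegOrthant (hx _ h)))
      (Eventually.of_forall fun k => hz'ge h _)
  exact ⟨ms', this ▸ hz'⟩

end Limit

end Trade

theorem mainTheorem2 {Ω : Type*} [MeasurableSpace Ω] (P : Measure Ω) [IsProbabilityMeasure P]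
    (u : Fin 2 → (Fin 2 → ℝ) → ℝ)
    (hu : ∀ h, Trade.IsUtility (u h))
    (hattractive : ∀ h, Trade.IsAttractive (u h))
    (hsharp : ∀ h, Trade.IsSharp (u h))
    (y : Fin 2 → Fin 2 → ℝ) (hy : y ∈ Trade.allocations 2 2)
    (Y : ℕ → Ω → Fin 2 → Fin 2 → ℝ) (Q : ℕ → Ω → Fin 1 → ℝ) (S : ℕ → Ω → Fin 2 → ℝ)
    (fQ : (Fin 1 → ℝ) → ℝ) (fS : (Fin 2 → ℝ) → ℝ)
    (hY : Trade.IsBSNTP u y P Y Q S fQ fS)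
    (hfQ : ∀ q ∈ Trade.tradePrices u y, 0 < fQ q)
    (hspeed : ∀ t, ∀ᵐ ω ∂P, (Trade.tradePrices u (Y t ω)).Nonempty → ‖S (t + 1) ω‖ = 1) :
    ∀ᵐ ω ∂P, ∃ z ∈ Trade.paretoSet u, Tendsto (fun t => Y t ω) atTop (𝓝 z) := by
  -- Rational endpoints leave only countably many exceptional null sets.
  have hgap : ∀ᵐ ω ∂P, ∀ a b : ℚ, a < b → ¬ ∀ t, Y t ω ∈ Trade.tradingAt u a b := by
    refine ae_all_iff.mpr fun a => ae_all_iff.mpr fun b => ?_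
    by_cases hab : a < b
    · filter_upwards [hY.ae_not_forall_tradingAt hu hsharp hattractive hfQ hspeed
        (Rat.cast_lt.mpr hab)] with ω hω _ using hω
    · exact Eventually.of_forall fun _ h => absurd h hab
  filter_upwards [hY.toIsSNTP.ae_isImprovement hu hsharp hattractive, hgap] with ω himp hω
  exact Trade.exists_tendsto_paretoSet hu hsharp (fun t => hY.state t ω) himp hω
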